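/- Let $A$ be a positive semi-definite real $k\times k$ matrix with diagonal entries $\sigma_1^2,\dots,\sigma_k^2$, let $X=(X_1,\dots,X_k)$ be a Gaussian random vector with mean $0$ and covariance $A$, and let $\Omega=\prod_{i=1}^k\Omega_i$, where each $\Omega_i$ is an open interval contained in $[0,1]$. Let $\phi$ and $\Phi$ be the density and the distribution function of the standard Gaussian measure on $\mathbb R$, and put $I=\phi\circ\Phi^{-1}$. For $t\ge 0$ and bounded measurable $f:\mathbb R\to\mathbb R$ let $$(P_t^{\sigma_i^2}f)(x)=\mathbb E f\bigl(e^{-t}x+\sqrt{1-e^{-2t}}\,Z\bigr),\qquad Z\sim\mathcal N(0,\sigma_i^2).$$ Let $J:\Omega\times[0,\infty]\to\mathbb R$ be bounded and continuous, and $\mathcal C^2$ on $\Omega\times(0,\infty)$. Let $\lambda_1,\dots,\lambda_k\ge 0$ with $\sum_i\lambda_i=1$, let $D(x)$ be the $k\times k$ diagonal matrix with $i$-th diagonal entry $\lambda_i\sigma_i^2/I(x_i)^2$, and let $\epsilon\ge 0$. Suppose that for every $x\in\Omega$ and every real $t>0$ $$\frac{\partial J}{\partial t}(x,t)\le 0\qquad\text{and}\qquad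 A\odot H_J(x,t)-\bigl(e^{2(t+\epsilon)}-1\bigr)\frac{\partial J}{\partial t}(x,t)\,D(x)\succcurlyeq 0,$$ where $H_J$ is the Hessian matrix of $J$ with respect to the variable $x\in\Omega$, $\odot$ is the entrywise product and $\succcurlyeq$ is the positive semi-definite order. Then for all measurable functions $f_i:\mathbb R\to\Omega_i$, $i=1,\dots,k$, $$\mathbb E\,J\bigl(P_\epsilon^{\sigma_1^2}f_1(X_1),\dots,P_\epsilon^{\sigma_k^2}f_k(X_k),0\bigr)\ \ge\ J\bigl(\mathbb E f_1(X_1),\dots,\mathbb E f_k(X_k),\infty\bigr).$$ -/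

import Mathlib

open MeasureTheory ProbabilityTheory Set
open scoped NNReal ENNReal Matrix

noncomputable section

/-- The standard Gaussian distribution function `Φ`. -/
def gaussCDF (x : ℝ) : ℝ := cdf (gaussianReal 0 1) x

/-- `Φ⁻¹`, the inverse of the (injective) function `Φ`; it is meaningful on `(0, 1)`, the range
of `Φ`. -/
def gaussQuantile (p : ℝ) : ℝ := Function.invFun gaussCDF p

/-- The Gaussian isoperimetric profile `I = φ ∘ Φ⁻¹` on `(0, 1)`, where `φ` is the standard
Gaussian density, with the usual convention `I 0 = I 1 = 0`. -/
def gaussProfile (p : ℝ) : ℝ :=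
  if p ∈ Ioo (0 : ℝ) 1 then gaussianPDFReal 0 1 (gaussQuantile p) else 0

/-- The one-dimensional Ornstein-Uhlenbeck operator with stationary measure `N(0, v)`:
`(P_t f)(x) = E f (e^{-t} x + √(1 - e^{-2t}) Z)` with `Z ∼ N(0, v)`; `v` is the variance. -/
def ouSemigroup (v : ℝ≥0) (t : ℝ) (f : ℝ → ℝ) (x : ℝ) : ℝ :=
  ∫ z, f (Real.exp (-t) * x + Real.sqrt (1 - Real.exp (-2 * t)) * z) ∂(gaussianReal 0 v)

/-- The partial derivative `∂_i F`. -/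
def partialD {k : ℕ} (i : Fin k) (F : (Fin k → ℝ) → ℝ) (x : Fin k → ℝ) : ℝ :=
  fderiv ℝ F x (Pi.single i 1)

/-- The Hessian matrix of `F` at `x`, with entries `∂_i ∂_j F (x)`. -/
def hessianMatrix {k : ℕ} (F : (Fin k → ℝ) → ℝ) (x : Fin k → ℝ) : Matrix (Fin k) (Fin k) ℝ :=
  Matrix.of fun i j => partialD i (partialD j F) x

/-- The time derivative `∂J/∂t (x, t)` at a real time `t > 0` of a function on `ℝᵏ × [0, ∞]`. -/
def timeDeriv {k : ℕ} (J : (Fin k → ℝ) → ℝ≥0∞ → ℝ) (x : Fin k → ℝ) (t : ℝ) : ℝ :=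
  deriv (fun s : ℝ => J x (ENNReal.ofReal s)) t

/-- The diagonal matrix `D(x)` with entries `λ_i σ_i² / I(x_i)²`, where `σ_i² = A_ii`. -/
def weightMatrix {k : ℕ} (A : Matrix (Fin k) (Fin k) ℝ) (lam : Fin k → ℝ) (x : Fin k → ℝ) :
    Matrix (Fin k) (Fin k) ℝ :=
  Matrix.diagonal fun i => lam i * A i i / gaussProfile (x i) ^ 2

end

open Filter Topology

/-! Interpolate by `F(t) = E J(P_{t+ε} f(X), t)` (`interpolant`). It tends to `E J(P_ε f(X), 0)` as
`t → 0` and to `J(E f(X), ∞)` as `t → ∞`, so it suffices that `F` is nonincreasing on `(0, ∞)`.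
Formally, `F'(t) = E[∂_t J - ∑ A_ij ∂_ij J w_i w_j]` with `w_i = (P_{t+ε} f_i)'(X_i)`.

The Hessian hypothesis, tested on `w`, bounds the double sum below by `∂_t J` times `∑ λ_i σ_i² w_i²
(e^{2(t+ε)} - 1) / I(P_{t+ε} f_i)²`. As `∂_t J ≤ 0` and `∑ λ_i = 1`, it remains to see that each
factor of `λ_i` is at most 1 (`timeDeriv_le_of_posSemidef`). This is the reverse isoperimetric bound
`ouSemigroup_gradient_bound`: by Gaussian integration by parts the derivative of `P_t f` is a first
moment of a `[0, 1]`-valued function, and among such functions of given mean the half-lines have the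
extreme first moment, namely `I` of the mean.

`F` is never differentiated. Since `e^{-s} X + √(1 - e^{-2s}) Y` has the law of `X` when `Y` is an
independent copy, `F(t)` is an average over `x` of Gaussian averages over `y`. A Taylor expansion of
`J` about the mean in `y`, at time `t + s`, yields `F(t + s) ≤ F(t) + o(s)` uniformly on compact
time intervals (`eventually_interpolant_step`), and summing small steps gives monotonicity
(`le_of_eventually_step`).

The expansion requires smooth `f_i` with values in compact subintervals. General measurable `f_i`
are almost everywhere limits of these (`exists_smooth_seq_tendsto_ae`), and both sides pass to the
limit by dominated convergence. -/

/-! ### Gaussian integration by parts and the extremality of half-lines -/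

lemma hasDerivAt_gaussianPDFReal (x : ℝ) :
    HasDerivAt (gaussianPDFReal 0 1) (-(x * gaussianPDFReal 0 1 x)) x := by
  have h : HasDerivAt (fun y : ℝ => -(y - 0) ^ 2 / (2 * ((1 : ℝ≥0) : ℝ))) (-x) x := by
    have := (((hasDerivAt_id x).sub_const 0).pow 2).neg.div_const (2 * ((1 : ℝ≥0) : ℝ))
    refine this.congr_deriv ?_
    simp only [id, NNReal.coe_one, sub_zero]
    push_cast
    ring
  have h2 := h.exp.const_mul ((√(2 * Real.pi * ((1 : ℝ≥0) : ℝ)))⁻¹)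
  rw [gaussianPDFReal_def]
  refine h2.congr_deriv ?_
  simp only []
  ring

lemma integrable_id_mul_gaussianPDFReal :
    Integrable (fun x : ℝ => x * gaussianPDFReal 0 1 x) := by
  have h : Integrable id (gaussianReal 0 1) := (memLp_id_gaussianReal 1).integrable (by simp)
  rw [gaussianReal_of_var_ne_zero 0 one_ne_zero,
    integrable_withDensity_iff_integrable_smul' (measurable_gaussianPDF 0 1)
      (ae_of_all _ fun _ => gaussianPDF_lt_top)] at h
  refine h.congr (ae_of_all _ fun x => ?_)
  simp [toReal_gaussianPDF, mul_comm]

/-- Gaussian integration by parts (Stein's identity) in dimension one. -/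
lemma integral_id_mul_gaussianReal {g g' : ℝ → ℝ} (hg : ∀ x, HasDerivAt g (g' x) x)
    (hg'm : Measurable g') {B M : ℝ} (hB : ∀ x, |g x| ≤ B) (hM : ∀ x, |g' x| ≤ M) :
    ∫ z, z * g z ∂gaussianReal 0 1 = ∫ z, g' z ∂gaussianReal 0 1 := by
  have hgc : Continuous g := continuous_iff_continuousAt.2 fun x => (hg x).continuousAt
  rw [integral_gaussianReal_eq_integral_smul one_ne_zero,
    integral_gaussianReal_eq_integral_smul one_ne_zero]
  have key := integral_mul_deriv_eq_deriv_mul_of_integrable (u := g)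
    (v := gaussianPDFReal 0 1) (u' := g') (v' := fun x => -(x * gaussianPDFReal 0 1 x))
    (fun x _ => hg x) (fun x _ => hasDerivAt_gaussianPDFReal x)
    ?_ ?_ ?_
  · calc ∫ x, gaussianPDFReal 0 1 x • (x * g x)
        = -∫ x, g x * -(x * gaussianPDFReal 0 1 x) := by
          rw [← integral_neg]; congr 1; ext x; simp only [smul_eq_mul]; ring
      _ = ∫ x, gaussianPDFReal 0 1 x • g' x := by
          rw [key, neg_neg]; congr 1; ext x; simp only [smul_eq_mul]; ring
  · exact integrable_id_mul_gaussianPDFReal.neg.bdd_mul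
      hgc.aestronglyMeasurable (ae_of_all _ hB)
  · exact (integrable_gaussianPDFReal 0 1).bdd_mul
      hg'm.aestronglyMeasurable (ae_of_all _ hM)
  · exact (integrable_gaussianPDFReal 0 1).bdd_mul
      hgc.aestronglyMeasurable (ae_of_all _ hB)

lemma setIntegral_Iic_id_gaussianReal (a : ℝ) :
    ∫ z in Iic a, z ∂gaussianReal 0 1 = -gaussianPDFReal 0 1 a := by
  have h0 : Tendsto (gaussianPDFReal 0 1) atBot (𝓝 0) :=
    tendsto_zero_of_hasDerivAt_of_integrableOn_Iic (a := a)
      (fun x _ => hasDerivAt_gaussianPDFReal x)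
      integrable_id_mul_gaussianPDFReal.neg.integrableOn
      (integrable_gaussianPDFReal 0 1).integrableOn
  have h := integral_Iic_of_hasDerivAt_of_tendsto' (a := a)
    (fun x _ => hasDerivAt_gaussianPDFReal x)
    integrable_id_mul_gaussianPDFReal.neg.integrableOn h0
  rw [← integral_indicator measurableSet_Iic, integral_gaussianReal_eq_integral_smul one_ne_zero]
  rw [integral_neg, sub_zero] at h
  rw [← h, neg_neg, ← integral_indicator measurableSet_Iic]
  congr 1; ext x
  by_cases hx : x ∈ Iic a
  · rw [indicator_of_mem hx, indicator_of_mem hx, smul_eq_mul, mul_comm]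
  · rw [indicator_of_notMem hx, indicator_of_notMem hx, smul_zero]

/-- The Gaussian measure has no atoms, so the distribution function has no jumps. With the limits at
`±∞` this makes every `p ∈ (0, 1)` a value of `Φ`. -/
lemma continuous_gaussCDF : Continuous gaussCDF := by
  have : NullSingletonClass (gaussianReal 0 1) := nullSingletonClass_gaussianReal one_ne_zero
  refine continuous_iff_continuousAt.2 fun x => ?_
  have hm : Monotone gaussCDF := monotone_cdf _
  rw [hm.continuousAt_iff_leftLim_eq_rightLim]
  have h2 : Function.rightLim gaussCDF x = gaussCDF x :=
    (cdf (gaussianReal 0 1)).rightLim_eq x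
  rw [h2]
  have h := (cdf (gaussianReal 0 1)).measure_singleton x
  rw [measure_cdf, measure_singleton, eq_comm, ENNReal.ofReal_eq_zero] at h
  refine le_antisymm (hm.leftLim_le le_rfl) (sub_nonpos.1 h)

lemma gaussCDF_gaussQuantile {p : ℝ} (hp : p ∈ Ioo (0 : ℝ) 1) : gaussCDF (gaussQuantile p) = p := by
  refine Function.invFun_eq ?_
  obtain ⟨a, ha⟩ := ((tendsto_cdf_atBot (gaussianReal 0 1)).eventually_lt_const hp.1).exists
  obtain ⟨b, hb⟩ := ((tendsto_cdf_atTop (gaussianReal 0 1)).eventually_const_lt hp.2).exists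
  exact mem_range_of_exists_le_of_exists_ge continuous_gaussCDF ⟨a, ha.le⟩ ⟨b, hb.le⟩

lemma integrable_of_abs_le {α : Type*} {m : MeasurableSpace α} {μ : Measure α}
    [IsFiniteMeasure μ] {g : α → ℝ} (hg : AEStronglyMeasurable g μ) {B : ℝ} (hB : ∀ x, |g x| ≤ B) :
    Integrable g μ :=
  Integrable.of_bound hg B (ae_of_all _ hB)

lemma abs_le_one_of_mem_Icc {u : ℝ} (h : u ∈ Icc (0 : ℝ) 1) : |u| ≤ 1 :=
  abs_le.2 ⟨by linarith [h.1], h.2⟩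

/-- Bathtub principle: a given mass has the smallest first moment when packed to the left of the
quantile `q`, where the moment is `-φ(q)`. -/
lemma neg_gaussProfile_le_integral_id_mul {g : ℝ → ℝ} (hg : Measurable g)
    (hg01 : ∀ x, g x ∈ Icc (0 : ℝ) 1) (hp : ∫ z, g z ∂gaussianReal 0 1 ∈ Ioo (0 : ℝ) 1) :
    -gaussProfile (∫ z, g z ∂gaussianReal 0 1) ≤ ∫ z, z * g z ∂gaussianReal 0 1 := by
  set p := ∫ z, g z ∂gaussianReal 0 1 with hpdef
  set q := gaussQuantile p
  have hid : Integrable (fun z : ℝ => z) (gaussianReal 0 1) :=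
    (memLp_id_gaussianReal 1).integrable (by simp)
  have hgb : ∀ x, |g x| ≤ 1 := fun x => abs_le_one_of_mem_Icc (hg01 x)
  have hgi : Integrable g (gaussianReal 0 1) :=
    integrable_of_abs_le hg.aestronglyMeasurable hgb
  have hzg : Integrable (fun z => z * g z) (gaussianReal 0 1) :=
    hid.mul_bdd hg.aestronglyMeasurable (ae_of_all _ hgb)
  have hq : (gaussianReal 0 1).real (Iic q) = p := by
    rw [← cdf_eq_real]; exact gaussCDF_gaussQuantile hp
  have hprof : gaussProfile p = gaussianPDFReal 0 1 q := if_pos hp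
  have h1 : ∫ z in Iic q, (z - q) ∂gaussianReal 0 1 = -gaussianPDFReal 0 1 q - q * p := by
    rw [integral_sub hid.integrableOn (integrable_const _).integrableOn,
      setIntegral_Iic_id_gaussianReal, setIntegral_const, hq, smul_eq_mul, mul_comm]
  have h2 : ∫ z, (z * g z - q * g z) ∂gaussianReal 0 1
      = ∫ z, z * g z ∂gaussianReal 0 1 - q * p := by
    rw [integral_sub hzg (hgi.const_mul q), integral_const_mul]
  -- Pointwise, `(z - q) 1_{z ≤ q} ≤ (z - q) g z`, because `0 ≤ g ≤ 1`. The `q p` terms of `h1` and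
  -- `h2` then cancel.
  have h3 : ∫ z in Iic q, (z - q) ∂gaussianReal 0 1
      ≤ ∫ z, (z * g z - q * g z) ∂gaussianReal 0 1 := by
    rw [← integral_indicator measurableSet_Iic]
    refine integral_mono ((hid.sub (integrable_const _)).indicator measurableSet_Iic)
      (hzg.sub (hgi.const_mul q)) fun z => ?_
    have := hg01 z
    by_cases hz : z ∈ Iic q
    · rw [indicator_of_mem hz]
      have hz' : z ≤ q := hz
      show z - q ≤ z * g z - q * g z
      nlinarith [this.2]
    · rw [indicator_of_notMem hz]
      have hz' : q < z := not_le.1 hz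
      show 0 ≤ z * g z - q * g z
      nlinarith [this.1]
  rw [hprof]; linarith

/-- Among functions with values in `[0, 1]` and prescribed Gaussian mean, half-lines maximise the
first moment. -/
lemma abs_integral_id_mul_le_gaussProfile {g : ℝ → ℝ} (hg : Measurable g)
    (hg01 : ∀ x, g x ∈ Icc (0 : ℝ) 1) (hp : ∫ z, g z ∂gaussianReal 0 1 ∈ Ioo (0 : ℝ) 1) :
    |∫ z, z * g z ∂gaussianReal 0 1| ≤ gaussProfile (∫ z, g z ∂gaussianReal 0 1) := by
  have hmap : (gaussianReal 0 1).map (fun z : ℝ => -z) = gaussianReal 0 1 := by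
    rw [gaussianReal_map_neg, neg_zero]
  have hneg : ∀ h : ℝ → ℝ, Measurable h →
      ∫ z, h (-z) ∂gaussianReal 0 1 = ∫ z, h z ∂gaussianReal 0 1 := fun h hh => by
    conv_rhs => rw [← hmap]
    rw [integral_map measurable_neg.aemeasurable hh.aestronglyMeasurable]
  have h1 := neg_gaussProfile_le_integral_id_mul hg hg01 hp
  -- Reflection turns the lower bound into the upper bound.
  have h2 := neg_gaussProfile_le_integral_id_mul (g := fun z => g (-z)) (hg.comp measurable_neg)
    (fun x => hg01 _) (by rw [hneg g hg]; exact hp)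
  rw [hneg g hg] at h2
  have h3 := hneg (fun z => z * g z) (measurable_id.mul hg)
  simp only [neg_mul, integral_neg] at h3
  exact abs_le.2 ⟨h1, by linarith⟩

/-! ### Stability of Gaussian measures and the Ornstein-Uhlenbeck semigroup -/

/-- Stability of centered Gaussian measures. -/
lemma map_smul_add_smul_prod_of_isGaussian {E : Type*} [NormedAddCommGroup E]
    [InnerProductSpace ℝ E] [MeasurableSpace E] [BorelSpace E] [SecondCountableTopology E]
    [CompleteSpace E] (μ : Measure E) [IsGaussian μ] (h0 : ∫ x, id x ∂μ = 0)
    {a b c : ℝ} (habc : a ^ 2 + b ^ 2 = c ^ 2) :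
    (μ.prod μ).map (fun p : E × E => a • p.1 + b • p.2) = μ.map (fun x => c • x) := by
  have h1 : (μ.prod μ).map (fun p : E × E => a • p.1 + b • p.2)
      = (μ.map (fun x => a • x)) ∗ (μ.map (fun x => b • x)) := by
    rw [Measure.conv, Measure.map_prod_map _ _ (by fun_prop) (by fun_prop),
      Measure.map_map (by fun_prop) (by fun_prop)]
    rfl
  have hc : ∀ (r : ℝ) (t : E), charFun (μ.map (fun x => r • x)) t
      = Complex.exp (-((r ^ 2 * covarianceBilin μ t t : ℝ) : ℂ) / 2) := fun r t => by
    rw [charFun_map_smul, IsGaussian.charFun_eq', h0]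
    simp only [inner_zero_right, Complex.ofReal_zero, zero_mul, zero_sub, map_smul,
      smul_apply, smul_eq_mul]
    congr 1
    push_cast
    ring
  rw [h1]
  have : IsProbabilityMeasure (μ.map (fun x => a • x)) :=
    Measure.isProbabilityMeasure_map (by fun_prop)
  have : IsProbabilityMeasure (μ.map (fun x => b • x)) :=
    Measure.isProbabilityMeasure_map (by fun_prop)
  have : IsProbabilityMeasure (μ.map (fun x => c • x)) :=
    Measure.isProbabilityMeasure_map (by fun_prop)
  refine Measure.ext_of_charFun ?_
  ext t
  rw [charFun_conv, hc, hc, hc, ← Complex.exp_add, ← habc]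
  congr 1
  push_cast
  ring

lemma ouScale_sq {t : ℝ} (ht : 0 ≤ t) :
    √(1 - Real.exp (-2 * t)) ^ 2 = 1 - Real.exp (-2 * t) :=
  Real.sq_sqrt (sub_nonneg.2 (Real.exp_le_one_iff.2 (by linarith)))

lemma exp_neg_sq_add_ouScale_sq {t : ℝ} (ht : 0 ≤ t) :
    Real.exp (-t) ^ 2 + √(1 - Real.exp (-2 * t)) ^ 2 = 1 ^ 2 := by
  rw [ouScale_sq ht, ← Real.exp_nat_mul]
  push_cast
  rw [show (2 : ℝ) * -t = -2 * t by ring]; ring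

lemma ouScale_le_one (t : ℝ) : √(1 - Real.exp (-2 * t)) ≤ 1 :=
  Real.sqrt_le_one.2 (by linarith [Real.exp_pos (-2 * t)])

lemma abs_integral_le_of_abs_le {α : Type*} {m : MeasurableSpace α} {μ : Measure α}
    [IsProbabilityMeasure μ] {F : α → ℝ} {C : ℝ} (h : ∀ z, |F z| ≤ C) : |∫ z, F z ∂μ| ≤ C := by
  simpa using norm_integral_le_of_norm_le_const (μ := μ) (f := F) (C := C) (ae_of_all _ h)

section semigroup

variable {v : ℝ≥0} {f : ℝ → ℝ} {B : ℝ}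

lemma integrable_ouSemigroup_integrand (hf : Measurable f) (hB : ∀ x, |f x| ≤ B) (a b : ℝ) :
    Integrable (fun z => f (a + b * z)) (gaussianReal 0 v) :=
  integrable_of_abs_le (hf.comp (by fun_prop)).aestronglyMeasurable (fun x => hB _)

lemma ouSemigroup_ouSemigroup (hf : Measurable f) (hB : ∀ x, |f x| ≤ B) {s t : ℝ}
    (hs : 0 ≤ s) (ht : 0 ≤ t) (x : ℝ) :
    ouSemigroup v s (ouSemigroup v t f) x = ouSemigroup v (s + t) f x := by
  -- The two independent noises add up to one, since `e^{-2t}(1 - e^{-2s}) + (1 - e^{-2t}) = 1 -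
  -- e^{-2(s+t)}`.
  have h := map_smul_add_smul_prod_of_isGaussian (gaussianReal 0 v)
    (by simp [integral_id_gaussianReal])
    (a := Real.exp (-t) * √(1 - Real.exp (-2 * s))) (b := √(1 - Real.exp (-2 * t)))
    (c := √(1 - Real.exp (-2 * (s + t)))) (by
      rw [mul_pow, ouScale_sq hs, ouScale_sq ht, ouScale_sq (add_nonneg hs ht),
        ← Real.exp_nat_mul]
      have h3 : Real.exp (-2 * (s + t)) = Real.exp (-2 * s) * Real.exp (-2 * t) := by
        rw [← Real.exp_add]; ring_nf
      rw [h3]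
      push_cast
      rw [show (2 : ℝ) * -t = -2 * t by ring]; ring)
  set x' := Real.exp (-(s + t)) * x with hx'
  have hF : Measurable (fun u => f (x' + u)) := hf.comp (by fun_prop)
  have e1 : ouSemigroup v (s + t) f x = ∫ u, f (x' + u)
      ∂((gaussianReal 0 v).map (fun z => √(1 - Real.exp (-2 * (s + t))) • z)) := by
    rw [integral_map (by fun_prop) hF.aestronglyMeasurable]; rfl
  rw [e1, ← h, integral_map (by fun_prop) hF.aestronglyMeasurable, integral_prod]
  · refine integral_congr_ae (ae_of_all _ fun y => integral_congr_ae (ae_of_all _ fun z => ?_))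
    simp only [smul_eq_mul, hx']
    congr 1
    rw [show -(s + t) = -s + -t by ring, Real.exp_add]
    ring
  · exact integrable_of_abs_le (hF.comp (by fun_prop)).aestronglyMeasurable (fun x => hB _)

lemma ouSemigroup_mem_Icc {c d : ℝ} (hf : Measurable f) (h : ∀ x, f x ∈ Icc c d) (t x : ℝ) :
    ouSemigroup v t f x ∈ Icc c d := by
  have hi := integrable_ouSemigroup_integrand (v := v) hf
    (fun x => abs_le_max_abs_abs (h x).1 (h x).2) (Real.exp (-t) * x) √(1 - Real.exp (-2 * t))
  constructor
  · have := integral_mono (integrable_const c) hi fun z => (h _).1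
    simpa [ouSemigroup] using this
  · have := integral_mono hi (integrable_const d) fun z => (h _).2
    simpa [ouSemigroup] using this

/-- The reverse isoperimetric (gradient) bound for the Ornstein-Uhlenbeck semigroup. -/
lemma ouSemigroup_gradient_bound {f' : ℝ → ℝ} {M : ℝ} (hf : ∀ x, HasDerivAt f (f' x) x)
    (hf'm : Measurable f') (hM : ∀ x, |f' x| ≤ M) (hf01 : ∀ x, f x ∈ Icc (0 : ℝ) 1) {t : ℝ}
    (ht : 0 ≤ t) (x : ℝ) (hp : ouSemigroup v t f x ∈ Ioo (0 : ℝ) 1) :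
    v * (Real.exp (-t) * ouSemigroup v t f' x) ^ 2 * (Real.exp (2 * t) - 1)
      ≤ gaussProfile (ouSemigroup v t f x) ^ 2 := by
  have hfm : Measurable f :=
    (continuous_iff_continuousAt.2 fun x => (hf x).continuousAt).measurable
  -- Rescaling to `N(0, 1)` also covers `v = 0`, where `N(0, v)` has no density.
  have hmap : gaussianReal 0 v = (gaussianReal 0 1).map (√(v : ℝ) * ·) := by
    rw [gaussianReal_map_const_mul]
    congr 1
    · simp
    · ext; simp
  set a := Real.exp (-t) * x
  set r := √(1 - Real.exp (-2 * t)) with hr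
  have hou : ∀ h : ℝ → ℝ, Measurable h → ouSemigroup v t h x
      = ∫ z, h (a + r * (√(v : ℝ) * z)) ∂gaussianReal 0 1 := fun h hh => by
    have hh' : Measurable (fun z => h (a + r * z)) := hh.comp (by fun_prop)
    rw [ouSemigroup, hmap]
    exact integral_map (by fun_prop) hh'.aestronglyMeasurable
  have hst := integral_id_mul_gaussianReal (g := fun z => f (a + r * (√(v : ℝ) * z)))
    (g' := fun z => f' (a + r * (√(v : ℝ) * z)) * (r * √(v : ℝ))) (B := 1)
    (M := M * |r * √(v : ℝ)|)
    (fun z => by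
      have h1 : HasDerivAt (fun z => a + r * (√(v : ℝ) * z)) (r * √(v : ℝ)) z := by
        have := (((hasDerivAt_id z).const_mul √(v : ℝ)).const_mul r).const_add a
        simpa using this
      exact (hf _).comp z h1)
    ((hf'm.comp (by fun_prop)).mul_const _)
    (fun z => abs_le_one_of_mem_Icc (hf01 _))
    (fun z => by rw [abs_mul]; exact mul_le_mul_of_nonneg_right (hM _) (abs_nonneg _))
  have hb := abs_integral_id_mul_le_gaussProfile (g := fun z => f (a + r * (√(v : ℝ) * z)))
    (hfm.comp (by fun_prop)) (fun z => hf01 _) (by rw [← hou f hfm]; exact hp)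
  rw [hst, integral_mul_const, ← hou f' hf'm, ← hou f hfm] at hb
  have hb2 := pow_le_pow_left₀ (abs_nonneg _) hb 2
  rw [sq_abs] at hb2
  refine le_trans (le_of_eq ?_) hb2
  rw [mul_pow, mul_pow, mul_pow, Real.sq_sqrt v.coe_nonneg, hr, ouScale_sq ht, ← Real.exp_nat_mul]
  -- The factor `1 - e^{-2t}` is the squared noise scale produced by the chain rule in Stein's
  -- identity.
  have : Real.exp (((2 : ℕ) : ℝ) * -t) * (Real.exp (2 * t) - 1) = 1 - Real.exp (-2 * t) := by
    rw [mul_sub, ← Real.exp_add, mul_one]; push_cast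
    rw [show (2 : ℝ) * -t + 2 * t = 0 by ring, Real.exp_zero, show (2 : ℝ) * -t = -2 * t by ring]
  rw [← this]; ring

end semigroup

/-! ### Difference bounds and fluctuations under the semigroup -/

/-- First- and second-order difference bounds for a function `g` with derivative `g'`. -/
structure TaylorBound (g g' : ℝ → ℝ) (M : ℝ) : Prop where
  lip : ∀ u w, |g u - g w| ≤ M * |u - w|
  lip' : ∀ u w, |g' u - g' w| ≤ M * |u - w|
  bdd' : ∀ u, |g' u| ≤ M
  quad : ∀ u h, |g (u + h) - g u - g' u * h| ≤ M * h ^ 2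

lemma continuous_of_abs_sub_le {g : ℝ → ℝ} {M : ℝ} (h : ∀ u w, |g u - g w| ≤ M * |u - w|) :
    Continuous g :=
  (LipschitzWith.of_dist_le_mul (K := M.toNNReal) fun u w =>
    (h u w).trans (mul_le_mul_of_nonneg_right (Real.le_coe_toNNReal M) (abs_nonneg _))).continuous

namespace TaylorBound

variable {g g' : ℝ → ℝ} {M : ℝ}

lemma nonneg (h : TaylorBound g g' M) : 0 ≤ M := (abs_nonneg _).trans (h.bdd' 0)

lemma continuous (h : TaylorBound g g' M) : Continuous g := continuous_of_abs_sub_le h.lip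

lemma continuous' (h : TaylorBound g g' M) : Continuous g' := continuous_of_abs_sub_le h.lip'

lemma abs_ouSemigroup_sub_le {q : ℝ → ℝ} {v : ℝ≥0} {t B : ℝ} (ht : 0 ≤ t) (hM : 0 ≤ M)
    (hB : ∀ x, |q x| ≤ B) (hq : ∀ u w, |q u - q w| ≤ M * |u - w|) (u w : ℝ) :
    |ouSemigroup v t q u - ouSemigroup v t q w| ≤ M * |u - w| := by
  have hqm := (continuous_of_abs_sub_le hq).measurable
  rw [ouSemigroup, ouSemigroup, ← integral_sub (integrable_ouSemigroup_integrand hqm hB _ _)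
    (integrable_ouSemigroup_integrand hqm hB _ _)]
  refine abs_integral_le_of_abs_le fun z => ?_
  refine (hq _ _).trans ?_
  rw [show Real.exp (-t) * u + √(1 - Real.exp (-2 * t)) * z
    - (Real.exp (-t) * w + √(1 - Real.exp (-2 * t)) * z) = Real.exp (-t) * (u - w) by ring,
    abs_mul, abs_of_pos (Real.exp_pos _)]
  have : Real.exp (-t) ≤ 1 := Real.exp_le_one_iff.2 (by linarith)
  exact mul_le_mul_of_nonneg_left (mul_le_of_le_one_left (abs_nonneg _) this) hM

lemma abs_ouSemigroup_le {q : ℝ → ℝ} {v : ℝ≥0} {t B : ℝ} (hB : ∀ x, |q x| ≤ B) (u : ℝ) :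
    |ouSemigroup v t q u| ≤ B :=
  abs_integral_le_of_abs_le fun _ => hB _

/-- Averaging preserves each bound and the contraction `e^{-t} ≤ 1` only helps. The constant `M` is
therefore independent of `t`, which makes the later error terms uniform in time. -/
lemma ouSemigroup (h : TaylorBound g g' M) {v : ℝ≥0} {t B : ℝ} (ht : 0 ≤ t)
    (hB : ∀ x, |g x| ≤ B) :
    TaylorBound (ouSemigroup v t g) (fun x => Real.exp (-t) * ouSemigroup v t g' x) M := by
  have he : Real.exp (-t) ≤ 1 := Real.exp_le_one_iff.2 (by linarith)
  have he0 := Real.exp_pos (-t)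
  refine ⟨abs_ouSemigroup_sub_le ht h.nonneg hB h.lip, fun u w => ?_, fun u => ?_, fun u k => ?_⟩
  · rw [← mul_sub, abs_mul, abs_of_pos he0]
    exact (mul_le_of_le_one_left (abs_nonneg _) he).trans
      (abs_ouSemigroup_sub_le ht h.nonneg h.bdd' h.lip' u w)
  · rw [abs_mul, abs_of_pos he0]
    exact (mul_le_of_le_one_left (abs_nonneg _) he).trans (abs_ouSemigroup_le h.bdd' u)
  · have hgm := h.continuous.measurable
    have hgm' := h.continuous'.measurable
    have i1 := fun x => integrable_ouSemigroup_integrand (v := v) hgm hB (Real.exp (-t) * x)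
      √(1 - Real.exp (-2 * t))
    have i2 := fun x => integrable_ouSemigroup_integrand (v := v) hgm' h.bdd' (Real.exp (-t) * x)
      √(1 - Real.exp (-2 * t))
    have e : _root_.ouSemigroup v t g (u + k) - _root_.ouSemigroup v t g u
        - Real.exp (-t) * _root_.ouSemigroup v t g' u * k
        = ∫ z, (g (Real.exp (-t) * (u + k) + √(1 - Real.exp (-2 * t)) * z)
          - g (Real.exp (-t) * u + √(1 - Real.exp (-2 * t)) * z)
          - g' (Real.exp (-t) * u + √(1 - Real.exp (-2 * t)) * z) * (Real.exp (-t) * k))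
          ∂gaussianReal 0 v := by
      rw [integral_sub (by exact (i1 _).sub (i1 _)) ((i2 _).mul_const _),
        integral_sub (i1 _) (i1 _), integral_mul_const]
      simp only [_root_.ouSemigroup]; ring
    rw [e]
    refine abs_integral_le_of_abs_le fun z => ?_
    have := h.quad (Real.exp (-t) * u + √(1 - Real.exp (-2 * t)) * z) (Real.exp (-t) * k)
    rw [show Real.exp (-t) * (u + k) + √(1 - Real.exp (-2 * t)) * z
      = Real.exp (-t) * u + √(1 - Real.exp (-2 * t)) * z + Real.exp (-t) * k by ring]
    refine this.trans (mul_le_mul_of_nonneg_left ?_ h.nonneg)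
    rw [mul_pow]
    exact mul_le_of_le_one_left (sq_nonneg _) (pow_le_one₀ he0.le he)

end TaylorBound

/-- The constant `E (1 + |Z|)²` for `Z ∼ N(0, v)`. -/
noncomputable def gaussMoment (v : ℝ≥0) : ℝ := ∫ y, (1 + |y|) ^ 2 ∂gaussianReal 0 v

lemma memLp_one_add_norm {E : Type*} [NormedAddCommGroup E] [InnerProductSpace ℝ E]
    [MeasurableSpace E] [BorelSpace E] [SecondCountableTopology E] [CompleteSpace E]
    (μ : Measure E) [IsGaussian μ] {p : ℝ≥0∞} (hp : p ≠ ∞) :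
    MemLp (fun y : E => 1 + ‖y‖) p μ := by
  have h1 : MemLp (fun _ : E => (1 : ℝ)) p μ := memLp_const 1
  have h2 : MemLp (fun y : E => ‖y‖) p μ := (IsGaussian.memLp_id μ p hp).norm
  exact h1.add h2

lemma abs_integral_le_integral {α : Type*} {m : MeasurableSpace α} {μ : Measure α}
    {F b : α → ℝ} (hb : Integrable b μ) (h : ∀ z, |F z| ≤ b z) :
    |∫ z, F z ∂μ| ≤ ∫ z, b z ∂μ :=
  norm_integral_le_of_norm_le (f := F) hb (ae_of_all _ h)

lemma integrable_one_add_norm_pow {E : Type*} [NormedAddCommGroup E] [InnerProductSpace ℝ E]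
    [MeasurableSpace E] [BorelSpace E] [SecondCountableTopology E] [CompleteSpace E]
    (μ : Measure E) [IsGaussian μ] (n : ℕ) : Integrable (fun y : E => (1 + ‖y‖) ^ n) μ := by
  have h := (memLp_one_add_norm μ (p := n) (by simp)).integrable_norm_pow'
  refine h.congr (ae_of_all _ fun y => ?_)
  simp only [Real.norm_eq_abs]
  rw [abs_of_nonneg (by positivity)]

lemma one_le_gaussMoment (v : ℝ≥0) : 1 ≤ gaussMoment v := by
  have h := integral_mono (integrable_const (1 : ℝ))
    (integrable_one_add_norm_pow (gaussianReal 0 v) 2) fun y => by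
      show (1 : ℝ) ≤ (1 + ‖y‖) ^ 2
      nlinarith [norm_nonneg y]
  simpa [gaussMoment] using h

lemma one_sub_exp_neg_le_ouScale_sq {s : ℝ} (hs : 0 ≤ s) :
    1 - Real.exp (-s) ≤ √(1 - Real.exp (-2 * s)) ^ 2 := by
  rw [ouScale_sq hs]
  have : Real.exp (-2 * s) ≤ Real.exp (-s) := Real.exp_le_exp.2 (by linarith)
  linarith

namespace TaylorBound

variable {g g' : ℝ → ℝ} {M B : ℝ} {v : ℝ≥0} {s : ℝ}

/-- The linear term of the expansion about `e^{-s} x` has mean zero, so the error is quadratic in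
the noise scale. -/
lemma abs_sub_ouSemigroup_le (h : TaylorBound g g' M) (hB : ∀ x, |g x| ≤ B) (x : ℝ) :
    |g (Real.exp (-s) * x) - _root_.ouSemigroup v s g x|
      ≤ M * gaussMoment v * √(1 - Real.exp (-2 * s)) ^ 2 := by
  set r := √(1 - Real.exp (-2 * s)) with hr
  set z := Real.exp (-s) * x with hz
  have i1 := integrable_ouSemigroup_integrand (v := v) h.continuous.measurable hB z r
  have i2 : Integrable (fun y : ℝ => g' z * (r * y)) (gaussianReal 0 v) :=
    (((memLp_id_gaussianReal 1).integrable (by simp)).const_mul r).const_mul _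
  have e0 : _root_.ouSemigroup v s g x = ∫ y, g (z + r * y) ∂gaussianReal 0 v := rfl
  have e : g z - _root_.ouSemigroup v s g x
      = -∫ y, (g (z + r * y) - g z - g' z * (r * y)) ∂gaussianReal 0 v := by
    rw [integral_sub (by exact i1.sub (integrable_const _)) i2, integral_sub i1 (integrable_const _),
      integral_const_mul, integral_const_mul, integral_id_gaussianReal, integral_const]
    simp [e0]
  rw [e, abs_neg]
  have hb : ∫ y, M * r ^ 2 * (1 + ‖y‖) ^ 2 ∂gaussianReal 0 v = M * gaussMoment v * r ^ 2 := by
    rw [integral_const_mul]; simp only [gaussMoment, Real.norm_eq_abs]; ring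
  rw [← hb]
  refine abs_integral_le_integral
    ((integrable_one_add_norm_pow (gaussianReal 0 v) 2).const_mul _) fun y => ?_
  refine (h.quad z (r * y)).trans ?_
  rw [mul_pow, mul_assoc]
  refine mul_le_mul_of_nonneg_left (mul_le_mul_of_nonneg_left ?_ (sq_nonneg _)) h.nonneg
  rw [← sq_abs, Real.norm_eq_abs]
  nlinarith [abs_nonneg y]

lemma abs_deriv_sub_ouSemigroup_le (h : TaylorBound g g' M) (hs : 0 ≤ s) (x : ℝ) :
    |g' (Real.exp (-s) * x) - Real.exp (-s) * _root_.ouSemigroup v s g' x|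
      ≤ 2 * M * gaussMoment v * √(1 - Real.exp (-2 * s)) := by
  set r := √(1 - Real.exp (-2 * s)) with hr
  set z := Real.exp (-s) * x with hz
  have hM := h.nonneg
  have hr0 : 0 ≤ r := Real.sqrt_nonneg _
  have i1 := integrable_ouSemigroup_integrand (v := v) h.continuous'.measurable h.bdd' z r
  have e0 : _root_.ouSemigroup v s g' x = ∫ y, g' (z + r * y) ∂gaussianReal 0 v := rfl
  have e : g' z - _root_.ouSemigroup v s g' x
      = -∫ y, (g' (z + r * y) - g' z) ∂gaussianReal 0 v := by
    rw [integral_sub i1 (integrable_const _), integral_const]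
    simp [e0]
  have hb : ∫ y, M * r * (1 + ‖y‖) ^ 2 ∂gaussianReal 0 v = M * gaussMoment v * r := by
    rw [integral_const_mul]; simp only [gaussMoment, Real.norm_eq_abs]; ring
  have h1 : |g' z - _root_.ouSemigroup v s g' x| ≤ M * gaussMoment v * r := by
    rw [e, abs_neg, ← hb]
    refine abs_integral_le_integral
      ((integrable_one_add_norm_pow (gaussianReal 0 v) 2).const_mul _) fun y => ?_
    refine (h.lip' _ _).trans ?_
    rw [add_sub_cancel_left, abs_mul, abs_of_nonneg hr0, mul_assoc, Real.norm_eq_abs]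
    refine mul_le_mul_of_nonneg_left (mul_le_mul_of_nonneg_left ?_ hr0) hM
    nlinarith [abs_nonneg y]
  have h2 : |_root_.ouSemigroup v s g' x - Real.exp (-s) * _root_.ouSemigroup v s g' x|
      ≤ M * r ^ 2 := by
    rw [show ∀ u e : ℝ, u - e * u = u * (1 - e) by intros; ring, abs_mul]
    have he : Real.exp (-s) ≤ 1 := Real.exp_le_one_iff.2 (by linarith)
    rw [abs_of_nonneg (sub_nonneg.2 he)]
    exact mul_le_mul (abs_ouSemigroup_le h.bdd' x) (one_sub_exp_neg_le_ouScale_sq hs)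
      (sub_nonneg.2 he) hM
  have h3 : M * r ^ 2 ≤ M * gaussMoment v * r := by
    rw [mul_assoc]
    refine mul_le_mul_of_nonneg_left ?_ hM
    nlinarith [one_le_gaussMoment v, ouScale_le_one s]
  have := abs_sub_le (g' z) (_root_.ouSemigroup v s g' x)
    (Real.exp (-s) * _root_.ouSemigroup v s g' x)
  linarith

/-- Size of the fluctuation of `g` around its mean under the Ornstein-Uhlenbeck kernel. -/
lemma abs_fluctuation_le (h : TaylorBound g g' M) (hB : ∀ x, |g x| ≤ B) (x y : ℝ) :
    |g (Real.exp (-s) * x + √(1 - Real.exp (-2 * s)) * y) - _root_.ouSemigroup v s g x|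
      ≤ M * gaussMoment v * √(1 - Real.exp (-2 * s)) * (1 + |y|) := by
  have h1 := h.abs_sub_ouSemigroup_le (v := v) (s := s) hB x
  set r := √(1 - Real.exp (-2 * s)) with hr
  set z := Real.exp (-s) * x with hz
  have hM := h.nonneg
  have hr0 : 0 ≤ r := Real.sqrt_nonneg _
  have hr1 : r ≤ 1 := ouScale_le_one s
  have hk := one_le_gaussMoment v
  have h2 : |g (z + r * y) - g z| ≤ M * (r * |y|) := by
    refine (h.lip _ _).trans_eq ?_
    rw [add_sub_cancel_left, abs_mul, abs_of_nonneg hr0]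
  have h3 := abs_sub_le (g (z + r * y)) (g z) (_root_.ouSemigroup v s g x)
  have h4 : M * (r * |y|) ≤ M * gaussMoment v * r * |y| := by
    have : 0 ≤ M * (r * |y|) := by positivity
    nlinarith
  have h5 : M * gaussMoment v * r ^ 2 ≤ M * gaussMoment v * r := by
    have : 0 ≤ M * gaussMoment v := mul_nonneg hM (by linarith)
    exact mul_le_mul_of_nonneg_left (by nlinarith) this
  linarith

/-- Three errors add up: the Taylor remainder at `e^{-s} x` (giving `|y|²`), the shift from `g` to
its mean (giving `1`), and the change of slope multiplied by `r y` (giving `2|y|`). Their sum is `(1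
+ |y|)²`. -/
lemma abs_fluctuation_sub_linear_le (h : TaylorBound g g' M) (hB : ∀ x, |g x| ≤ B) (hs : 0 ≤ s)
    (x y : ℝ) :
    |g (Real.exp (-s) * x + √(1 - Real.exp (-2 * s)) * y) - _root_.ouSemigroup v s g x
        - √(1 - Real.exp (-2 * s)) * (Real.exp (-s) * _root_.ouSemigroup v s g' x) * y|
      ≤ M * gaussMoment v * √(1 - Real.exp (-2 * s)) ^ 2 * (1 + |y|) ^ 2 := by
  have h1 := h.abs_sub_ouSemigroup_le (v := v) (s := s) hB x
  have h2 := h.abs_deriv_sub_ouSemigroup_le (v := v) hs x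
  set r := √(1 - Real.exp (-2 * s)) with hr
  set z := Real.exp (-s) * x with hz
  set w := Real.exp (-s) * _root_.ouSemigroup v s g' x
  have hM := h.nonneg
  have hr0 : 0 ≤ r := Real.sqrt_nonneg _
  have hk := one_le_gaussMoment v
  have h3 := h.quad z (r * y)
  have h4 : |(g' z - w) * (r * y)| ≤ 2 * M * gaussMoment v * r * (r * |y|) := by
    rw [abs_mul, abs_mul, abs_of_nonneg hr0]
    exact mul_le_mul_of_nonneg_right h2 (by positivity)
  have e : g (z + r * y) - _root_.ouSemigroup v s g x - r * w * y
      = (g (z + r * y) - g z - g' z * (r * y)) + (g z - _root_.ouSemigroup v s g x)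
        + (g' z - w) * (r * y) := by ring
  rw [e]
  refine (abs_add_three _ _ _).trans ((add_le_add (add_le_add h3 h1) h4).trans ?_)
  have h5 : M * (r * y) ^ 2 ≤ M * gaussMoment v * r ^ 2 * |y| ^ 2 := by
    rw [mul_pow, ← sq_abs y]
    have : 0 ≤ M * (r ^ 2 * |y| ^ 2) := by positivity
    nlinarith
  nlinarith

end TaylorBound

/-! ### Uniform Taylor expansion and the Hessian condition -/

/-- Second-order Taylor expansion on a compact convex set, with a remainder uniform in the base
point. -/
lemma exists_taylor_two_bound {E : Type*} [NormedAddCommGroup E] [NormedSpace ℝ E]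
    {U K : Set E} (hU : IsOpen U) (hKU : K ⊆ U) (hK : IsCompact K) (hKc : Convex ℝ K) {G : E → ℝ}
    (hG : ContDiffOn ℝ 2 G U) {η : ℝ} (hη : 0 < η) :
    ∃ C, 0 ≤ C ∧ ∀ p ∈ K, ∀ h, p + h ∈ K →
      |G (p + h) - G p - fderiv ℝ G p h - fderiv ℝ (fderiv ℝ G) p h h / 2|
        ≤ (η + C * ‖h‖ ^ 2) * ‖h‖ ^ 2 := by
  have hG1 : ContDiffOn ℝ 1 (fderiv ℝ G) U := hG.fderiv_of_isOpen hU (by norm_num)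
  have hG2 : ContinuousOn (fderiv ℝ (fderiv ℝ G)) U :=
    hG1.continuousOn_fderiv_of_isOpen hU (by norm_num)
  have hd1 : ∀ p ∈ U, HasFDerivAt G (fderiv ℝ G p) p := fun p hp =>
    ((hG.differentiableOn (by norm_num)).differentiableAt (hU.mem_nhds hp)).hasFDerivAt
  have hd2 : ∀ p ∈ U, HasFDerivAt (fderiv ℝ G) (fderiv ℝ (fderiv ℝ G) p) p := fun p hp =>
    ((hG1.differentiableOn (by norm_num)).differentiableAt (hU.mem_nhds hp)).hasFDerivAt
  have huc := hK.uniformContinuousOn_of_continuous (hG2.mono hKU)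
  obtain ⟨ρ, hρ, hρ'⟩ := (Metric.uniformContinuousOn_iff (β := E →L[ℝ] E →L[ℝ] ℝ)).1 huc η hη
  obtain ⟨D, hD⟩ := hK.exists_bound_of_continuousOn (E := E →L[ℝ] E →L[ℝ] ℝ) (hG2.mono hKU)
  -- The oscillation is at most `η` below distance `ρ`. Beyond it the trivial bound `2|D|` is
  -- absorbed by `2|D|/ρ² ‖q - p‖²`. The result is polynomial in the increment, hence integrable
  -- against a Gaussian without truncation.
  have key : ∀ p ∈ K, ∀ q ∈ K, ‖fderiv ℝ (fderiv ℝ G) q - fderiv ℝ (fderiv ℝ G) p‖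
      ≤ η + 2 * |D| / ρ ^ 2 * ‖q - p‖ ^ 2 := by
    intro p hp q hq
    by_cases hpq : dist q p < ρ
    · have h1 := hρ' q hq p hp hpq
      have h3 : ‖fderiv ℝ (fderiv ℝ G) q - fderiv ℝ (fderiv ℝ G) p‖ ≤ η :=
        (dist_eq_norm (E := E →L[ℝ] E →L[ℝ] ℝ) _ _).ge.trans h1.le
      have h2 : 0 ≤ 2 * |D| / ρ ^ 2 * ‖q - p‖ ^ 2 := by positivity
      linarith
    · rw [dist_eq_norm, not_lt] at hpq
      have h1 := norm_sub_le (fderiv ℝ (fderiv ℝ G) q) (fderiv ℝ (fderiv ℝ G) p)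
      have h2 : 2 * |D| ≤ 2 * |D| / ρ ^ 2 * ‖q - p‖ ^ 2 := by
        rw [div_mul_eq_mul_div, le_div_iff₀ (by positivity)]
        gcongr
      have := hD p hp
      have := hD q hq
      linarith [le_abs_self D]
  refine ⟨2 * |D| / ρ ^ 2, by positivity, fun p hp h hph => ?_⟩
  set C := 2 * |D| / ρ ^ 2 with hC
  have hC0 : 0 ≤ C := by positivity
  set T := fderiv ℝ (fderiv ℝ G) p with hT
  have hseg : ∀ θ ∈ Icc (0 : ℝ) 1, p + θ • h ∈ K := fun θ hθ =>
    hKc.add_smul_mem hp hph hθ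
  have hline : ∀ θ : ℝ, HasDerivAt (fun θ : ℝ => p + θ • h) h θ := fun θ => by
    simpa using ((hasDerivAt_id θ).smul_const h).const_add p
  -- The mean value inequality is used twice along the segment: here for the gradient minus its
  -- linearisation, then for `G` minus its quadratic part.
  have first : ∀ θ ∈ Icc (0 : ℝ) 1,
      ‖fderiv ℝ G (p + θ • h) - fderiv ℝ G p - θ • T h‖ ≤ (η + C * ‖h‖ ^ 2) * ‖h‖ := by
    intro θ hθ
    have := norm_image_sub_le_of_norm_deriv_le_segment' (a := 0) (b := 1)
      (f := fun θ : ℝ => fderiv ℝ G (p + θ • h) - θ • T h)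
      (f' := fun θ => (fderiv ℝ (fderiv ℝ G) (p + θ • h) - T) h)
      (C := (η + C * ‖h‖ ^ 2) * ‖h‖) (fun u hu => by
        have h1 := (hd2 _ (hKU (hseg u hu))).comp_hasDerivAt u (hline u)
        have h2 := (hasDerivAt_id u).smul_const (T h)
        exact ((h1.sub h2).congr_deriv (by simp)).hasDerivWithinAt)
      (fun u hu => by
        refine (ContinuousLinearMap.le_opNorm _ _).trans
          (mul_le_mul_of_nonneg_right ?_ (norm_nonneg h))
        refine (key p hp _ (hseg u ⟨hu.1, hu.2.le⟩)).trans ?_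
        rw [add_sub_cancel_left, norm_smul, Real.norm_eq_abs, abs_of_nonneg hu.1]
        have : u * ‖h‖ ≤ ‖h‖ := mul_le_of_le_one_left (norm_nonneg h) hu.2.le
        have h0 : 0 ≤ u * ‖h‖ := mul_nonneg hu.1 (norm_nonneg h)
        gcongr) θ hθ
    simp only [zero_smul, add_zero, sub_zero] at this
    rw [sub_right_comm]
    refine this.trans (mul_le_of_le_one_right ?_ hθ.2)
    positivity
  have second := norm_image_sub_le_of_norm_deriv_le_segment_01'
    (f := fun θ : ℝ => G (p + θ • h) - θ * fderiv ℝ G p h - θ ^ 2 / 2 * T h h)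
    (f' := fun θ => (fderiv ℝ G (p + θ • h) - fderiv ℝ G p - θ • T h) h)
    (C := (η + C * ‖h‖ ^ 2) * ‖h‖ ^ 2) (fun u hu => by
      have h1 := (hd1 _ (hKU (hseg u hu))).comp_hasDerivAt u (hline u)
      have h2 := (hasDerivAt_id u).mul_const (fderiv ℝ G p h)
      have h3 := (((hasDerivAt_id u).pow 2).div_const 2).mul_const (T h h)
      refine (((h1.sub h2).sub h3).congr_deriv ?_).hasDerivWithinAt
      simp)
    (fun u hu => by
      refine (ContinuousLinearMap.le_opNorm _ _).trans ?_
      rw [pow_two ‖h‖, ← mul_assoc, ← pow_two ‖h‖]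
      exact mul_le_mul_of_nonneg_right (first u ⟨hu.1, hu.2.le⟩) (norm_nonneg h))
  simp only [one_smul, zero_smul, add_zero] at second
  rw [Real.norm_eq_abs] at second
  convert second using 2
  ring

section hessian

variable {k : ℕ} {J : (Fin k → ℝ) → ℝ≥0∞ → ℝ} {Ω : Set (Fin k → ℝ)}

/-- The restriction of a function on `ℝᵏ × [0, ∞]` to real times. -/
def realTime (J : (Fin k → ℝ) → ℝ≥0∞ → ℝ) (p : (Fin k → ℝ) × ℝ) : ℝ :=
  J p.1 (ENNReal.ofReal p.2)

lemma timeDeriv_eq {x : Fin k → ℝ} {t : ℝ} (h : DifferentiableAt ℝ (realTime J) (x, t)) :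
    timeDeriv J x t = fderiv ℝ (realTime J) (x, t) (0, 1) := by
  have h1 : HasDerivAt (fun s : ℝ => (x, s)) ((0 : Fin k → ℝ), (1 : ℝ)) t :=
    (hasDerivAt_const t x).prodMk (hasDerivAt_id t)
  exact (h.hasFDerivAt.comp_hasDerivAt t h1).deriv

lemma partialD_eq {x : Fin k → ℝ} {t : ℝ} (i : Fin k)
    (h : DifferentiableAt ℝ (realTime J) (x, t)) :
    partialD i (fun y => J y (ENNReal.ofReal t)) x
      = fderiv ℝ (realTime J) (x, t) (Pi.single i 1, 0) := by
  have h1 : HasFDerivAt (fun y : Fin k → ℝ => (y, t))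
      (ContinuousLinearMap.inl ℝ (Fin k → ℝ) ℝ) x :=
    (hasFDerivAt_id x).prodMk (hasFDerivAt_const t x)
  have h2 := (h.hasFDerivAt.comp x h1).fderiv
  have h3 : fderiv ℝ (fun y => J y (ENNReal.ofReal t)) x
    = (fderiv ℝ (realTime J) (x, t)).comp (ContinuousLinearMap.inl ℝ (Fin k → ℝ) ℝ) := h2
  rw [partialD, h3]
  rfl

lemma hessianMatrix_eq (hΩ : IsOpen Ω) (hJ : ContDiffOn ℝ 2 (realTime J) (Ω ×ˢ Ioi (0 : ℝ)))
    {x : Fin k → ℝ} (hx : x ∈ Ω) {t : ℝ} (ht : 0 < t) (i j : Fin k) :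
    hessianMatrix (fun y => J y (ENNReal.ofReal t)) x i j
      = fderiv ℝ (fderiv ℝ (realTime J)) (x, t) (Pi.single i 1, 0) (Pi.single j 1, 0) := by
  have hU : IsOpen (Ω ×ˢ Ioi (0 : ℝ)) := hΩ.prod isOpen_Ioi
  have hd1 : ∀ p ∈ Ω ×ˢ Ioi (0 : ℝ), DifferentiableAt ℝ (realTime J) p := fun p hp =>
    (hJ.differentiableOn (by norm_num)).differentiableAt (hU.mem_nhds hp)
  have hd2 : DifferentiableAt ℝ (fderiv ℝ (realTime J)) (x, t) :=
    ((hJ.fderiv_of_isOpen hU (m := 1) (by norm_num)).differentiableOn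
      (by norm_num)).differentiableAt (hU.mem_nhds ⟨hx, ht⟩)
  have h1 : HasFDerivAt (fun y : Fin k → ℝ => (y, t))
      (ContinuousLinearMap.inl ℝ (Fin k → ℝ) ℝ) x :=
    (hasFDerivAt_id x).prodMk (hasFDerivAt_const t x)
  have h2 := (hd2.hasFDerivAt.comp x h1).clm_apply
    (hasFDerivAt_const ((Pi.single j 1, 0) : (Fin k → ℝ) × ℝ) x)
  have h3 : partialD j (fun y => J y (ENNReal.ofReal t))
      =ᶠ[𝓝 x] fun y => fderiv ℝ (realTime J) (y, t) (Pi.single j 1, 0) := by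
    filter_upwards [hΩ.mem_nhds hx] with y hy
    exact partialD_eq j (hd1 _ ⟨hy, ht⟩)
  rw [hessianMatrix, Matrix.of_apply, partialD, h3.fderiv_eq]
  erw [h2.fderiv]
  simp

lemma prod_zero_eq_sum (δ : Fin k → ℝ) :
    ((δ, 0) : (Fin k → ℝ) × ℝ) = ∑ i, δ i • ((Pi.single i 1, 0) : (Fin k → ℝ) × ℝ) := by
  refine Prod.ext ?_ ?_
  · rw [Prod.fst_sum]
    ext j
    simp [Finset.sum_apply, Pi.single_apply]
  · rw [Prod.snd_sum]; simp

lemma clm_apply_prod_zero (L : (Fin k → ℝ) × ℝ →L[ℝ] ℝ) (δ : Fin k → ℝ) :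
    L (δ, 0) = ∑ i, δ i * L (Pi.single i 1, 0) := by
  rw [prod_zero_eq_sum, map_sum]
  simp only [map_smul, smul_eq_mul]

lemma clm_apply_apply_prod_zero (T : (Fin k → ℝ) × ℝ →L[ℝ] (Fin k → ℝ) × ℝ →L[ℝ] ℝ)
    (δ : Fin k → ℝ) :
    T (δ, 0) (δ, 0) = ∑ i, ∑ j, δ i * δ j * T (Pi.single i 1, 0) (Pi.single j 1, 0) := by
  have h1 : T (δ, 0) = ∑ i, δ i • T (Pi.single i 1, 0) := by
    rw [prod_zero_eq_sum, map_sum]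
    simp only [map_smul]
  rw [h1, sum_apply]
  refine Finset.sum_congr rfl fun i _ => ?_
  rw [smul_apply, clm_apply_prod_zero, smul_eq_mul, Finset.mul_sum]
  exact Finset.sum_congr rfl fun j _ => by ring

/-- The Hessian condition, tested against a vector satisfying the gradient bound, dominates the
time derivative. -/
lemma timeDeriv_le_of_posSemidef {A H : Matrix (Fin k) (Fin k) ℝ} {lam x w : Fin k → ℝ}
    {c τ : ℝ} (hlam : ∀ i, 0 ≤ lam i) (hsum : ∑ i, lam i = 1) (hτ : τ ≤ 0)
    (h : (A ⊙ H - (c * τ) • weightMatrix A lam x).PosSemidef)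
    (hw : ∀ i, A i i * w i ^ 2 * c ≤ gaussProfile (x i) ^ 2) :
    τ ≤ ∑ i, ∑ j, A i j * H i j * (w i * w j) := by
  have h1 := h.dotProduct_mulVec_nonneg w
  have h2 : star w ⬝ᵥ ((A ⊙ H - (c * τ) • weightMatrix A lam x) *ᵥ w)
      = (∑ i, ∑ j, A i j * H i j * (w i * w j))
        - τ * ∑ i, c * (lam i * A i i / gaussProfile (x i) ^ 2) * w i ^ 2 := by
    rw [Matrix.sub_mulVec, dotProduct_sub, Matrix.smul_mulVec, dotProduct_smul, weightMatrix]
    congr 1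
    · simp only [dotProduct, Matrix.mulVec, Matrix.hadamard_apply, Finset.mul_sum]
      refine Finset.sum_congr rfl fun i _ => Finset.sum_congr rfl fun j _ => ?_
      simp only [Pi.star_apply, star_trivial]; ring
    · simp only [dotProduct, Matrix.mulVec_diagonal, smul_eq_mul, Finset.mul_sum]
      refine Finset.sum_congr rfl fun i _ => ?_
      simp only [Pi.star_apply, star_trivial]; ring
  rw [h2] at h1
  have h3 : ∑ i, c * (lam i * A i i / gaussProfile (x i) ^ 2) * w i ^ 2 ≤ 1 := by
    rw [← hsum]
    refine Finset.sum_le_sum fun i _ => ?_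
    have e : c * (lam i * A i i / gaussProfile (x i) ^ 2) * w i ^ 2
      = lam i * (A i i * w i ^ 2 * c / gaussProfile (x i) ^ 2) := by ring
    rw [e]
    -- The quotient is at most 1 even if the profile vanishes, because division by zero gives 0.
    exact mul_le_of_le_one_right (hlam i) (div_le_one_of_le₀ (hw i) (sq_nonneg _))
  -- Since `τ ≤ 0` and the weighted sum is at most 1, `τ` times the sum is at least `τ`.
  nlinarith

end hessian

/-! ### The one-step expansion, pointwise and integrated -/

section step

variable {k : ℕ}

lemma norm_single_prod_zero_le (i : Fin k) :
    ‖((Pi.single i 1, 0) : (Fin k → ℝ) × ℝ)‖ ≤ 1 := by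
  rw [Prod.norm_def, norm_zero]
  refine max_le ((pi_norm_le_iff_of_nonneg zero_le_one).2 fun j => ?_) zero_le_one
  by_cases h : j = i
  · subst h; simp
  · simp [h]

lemma abs_mul_sub_mul_le {a b u v α β : ℝ} (hb : |b| ≤ β) (hu : |u| ≤ β)
    (ha : |a - u| ≤ α) (hv : |b - v| ≤ α) : |a * b - u * v| ≤ 2 * (α * β) := by
  have hα : 0 ≤ α := (abs_nonneg _).trans ha
  have h1 : |(a - u) * b| ≤ α * β := by
    rw [abs_mul]; exact mul_le_mul ha hb (abs_nonneg _) hα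
  have h2 : |u * (b - v)| ≤ α * β := by
    rw [abs_mul, mul_comm]; exact mul_le_mul hv hu (abs_nonneg _) hα
  rw [show a * b - u * v = (a - u) * b + u * (b - v) by ring]
  linarith [abs_add_le ((a - u) * b) (u * (b - v))]

/-- Deterministic part of the one-step estimate: a second-order expansion in which the space
increment `δ` is replaced by its linearisation `r w_i y_i` in the quadratic term. -/
lemma taylor_step_pointwise (L : (Fin k → ℝ) × ℝ →L[ℝ] ℝ)
    (T : (Fin k → ℝ) × ℝ →L[ℝ] (Fin k → ℝ) × ℝ →L[ℝ] ℝ) {G₀ G₁ η C D c r s n : ℝ}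
    {δ w y : Fin k → ℝ} (hη : 0 ≤ η) (hC : 0 ≤ C) (hT : ‖T‖ ≤ D) (hc : 1 ≤ c) (hr : 0 ≤ r)
    (hs : 0 ≤ s) (hs1 : s ≤ 1) (hrs : r ^ 2 ≤ 2 * s) (hn : 1 ≤ n)
    (hG : |G₁ - G₀ - L (δ, -s) - T (δ, -s) (δ, -s) / 2|
      ≤ (η + C * ‖((δ, -s) : (Fin k → ℝ) × ℝ)‖ ^ 2) * ‖((δ, -s) : (Fin k → ℝ) × ℝ)‖ ^ 2)
    (hy : ∀ i, |y i| ≤ n) (hw : ∀ i, |w i| ≤ c) (hδ : ∀ i, |δ i| ≤ c * r * n)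
    (hδw : ∀ i, |δ i - r * w i * y i| ≤ c * r ^ 2 * n ^ 2) :
    G₀ + (∑ i, δ i * (L (Pi.single i 1, 0)
        - s / 2 * (T (Pi.single i 1, 0) (0, 1) + T (0, 1) (Pi.single i 1, 0)))) - s * L (0, 1)
      + r ^ 2 / 2 * ∑ i, ∑ j, T (Pi.single i 1, 0) (Pi.single j 1, 0) * (w i * w j) * (y i * y j)
      - (2 * k ^ 2 * D * c ^ 2 * r + D * s + 3 * c ^ 2 * η + 9 * C * c ^ 4 * s) * s * n ^ 4
      ≤ G₁ := by
  have hD : 0 ≤ D := (norm_nonneg T).trans hT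
  have hTb : ∀ u v : (Fin k → ℝ) × ℝ, ‖u‖ ≤ 1 → ‖v‖ ≤ 1 → |T u v| ≤ D := fun u v hu hv => by
    refine (T.le_opNorm₂ u v).trans ?_
    calc ‖T‖ * ‖u‖ * ‖v‖ ≤ D * 1 * 1 := by gcongr
      _ = D := by ring
  have hn0 : 0 ≤ n := by linarith
  have e0 : ((δ, -s) : (Fin k → ℝ) × ℝ) = (δ, 0) + (-s) • (0, 1) := by simp
  have eL : L (δ, -s) = ∑ i, δ i * L (Pi.single i 1, 0) - s * L (0, 1) := by
    rw [e0, map_add, map_smul, clm_apply_prod_zero, smul_eq_mul]; ring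
  have eT : T (δ, -s) (δ, -s) = ∑ i, ∑ j, δ i * δ j * T (Pi.single i 1, 0) (Pi.single j 1, 0)
      - s * ∑ i, δ i * (T (Pi.single i 1, 0) (0, 1) + T (0, 1) (Pi.single i 1, 0))
      + s ^ 2 * T (0, 1) (0, 1) := by
    have h1 : T (δ, 0) (0, 1) = ∑ i, δ i * T (Pi.single i 1, 0) (0, 1) :=
      clm_apply_prod_zero (T.flip (0, 1)) δ
    have h2 : T (0, 1) (δ, 0) = ∑ i, δ i * T (0, 1) (Pi.single i 1, 0) :=
      clm_apply_prod_zero (T (0, 1)) δ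
    simp only [mul_add, Finset.sum_add_distrib]
    rw [← h1, ← h2, ← clm_apply_apply_prod_zero, e0]
    simp only [map_add, map_smul, add_apply, smul_apply, smul_eq_mul]
    ring
  -- The product carries the maximum norm. The space part uses `r² ≤ 2s` and the time part `s² ≤ s`;
  -- the constant 3 covers both.
  have hnorm : ‖((δ, -s) : (Fin k → ℝ) × ℝ)‖ ^ 2 ≤ 3 * c ^ 2 * s * n ^ 2 := by
    have h1 : ‖((δ, -s) : (Fin k → ℝ) × ℝ)‖ ≤ max (c * r * n) s := by
      rw [Prod.norm_def]
      refine max_le_max ((pi_norm_le_iff_of_nonneg (by positivity)).2 hδ) ?_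
      simp [abs_of_nonneg hs]
    refine (pow_le_pow_left₀ (norm_nonneg _) h1 2).trans ?_
    have hc2 : 1 ≤ c ^ 2 := one_le_pow₀ hc
    have hn2 : 1 ≤ n ^ 2 := one_le_pow₀ hn
    rcases max_cases (c * r * n) s with ⟨h, _⟩ | ⟨h, _⟩ <;> rw [h]
    · calc (c * r * n) ^ 2 = c ^ 2 * n ^ 2 * r ^ 2 := by ring
        _ ≤ c ^ 2 * n ^ 2 * (3 * s) := by gcongr; linarith
        _ = 3 * c ^ 2 * s * n ^ 2 := by ring
    · calc s ^ 2 ≤ 3 * 1 * s * 1 := by nlinarith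
        _ ≤ 3 * c ^ 2 * s * n ^ 2 := by gcongr
  have hrem : (η + C * ‖((δ, -s) : (Fin k → ℝ) × ℝ)‖ ^ 2) * ‖((δ, -s) : (Fin k → ℝ) × ℝ)‖ ^ 2
      ≤ (3 * c ^ 2 * η + 9 * C * c ^ 4 * s) * s * n ^ 4 := by
    have hn24 : n ^ 2 ≤ n ^ 4 := pow_le_pow_right₀ hn (by norm_num)
    calc _ ≤ (η + C * (3 * c ^ 2 * s * n ^ 2)) * (3 * c ^ 2 * s * n ^ 2) := by gcongr
      _ = 3 * c ^ 2 * η * s * n ^ 2 + 9 * C * c ^ 4 * s * s * n ^ 4 := by ring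
      _ ≤ 3 * c ^ 2 * η * s * n ^ 4 + 9 * C * c ^ 4 * s * s * n ^ 4 := by gcongr
      _ = _ := by ring
  have hquad : |∑ i, ∑ j, δ i * δ j * T (Pi.single i 1, 0) (Pi.single j 1, 0)
      - r ^ 2 * ∑ i, ∑ j, T (Pi.single i 1, 0) (Pi.single j 1, 0) * (w i * w j) * (y i * y j)|
      ≤ 4 * k ^ 2 * D * c ^ 2 * r * s * n ^ 4 := by
    have e : ∑ i, ∑ j, δ i * δ j * T (Pi.single i 1, 0) (Pi.single j 1, 0)
      - r ^ 2 * ∑ i, ∑ j, T (Pi.single i 1, 0) (Pi.single j 1, 0) * (w i * w j) * (y i * y j)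
      = ∑ i, ∑ j, (δ i * δ j - (r * w i * y i) * (r * w j * y j))
          * T (Pi.single i 1, 0) (Pi.single j 1, 0) := by
      simp only [Finset.mul_sum, ← Finset.sum_sub_distrib]
      exact Finset.sum_congr rfl fun i _ => Finset.sum_congr rfl fun j _ => by ring
    -- Each factor has size `c r n` and linearisation error `c r² n²`, so a product is off by `O(r³
    -- n³)`, which is `O(r s n⁴)`.
    have hij : ∀ i j, |(δ i * δ j - (r * w i * y i) * (r * w j * y j))
        * T (Pi.single i 1, 0) (Pi.single j 1, 0)| ≤ 4 * D * c ^ 2 * r * s * n ^ 4 := fun i j => by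
      have hu : |r * w i * y i| ≤ c * r * n := by
        rw [abs_mul, abs_mul, abs_of_nonneg hr]
        calc r * |w i| * |y i| ≤ r * c * n := by gcongr; exacts [hw i, hy i]
          _ = c * r * n := by ring
      have h1 := abs_mul_sub_mul_le (hδ j) hu (hδw i) (hδw j)
      rw [abs_mul]
      calc _ ≤ 2 * (c * r ^ 2 * n ^ 2 * (c * r * n)) * D := by
            gcongr
            exact hTb _ _ (norm_single_prod_zero_le i) (norm_single_prod_zero_le j)
        _ = 2 * D * c ^ 2 * r * r ^ 2 * n ^ 3 := by ring
        _ ≤ 2 * D * c ^ 2 * r * (2 * s) * n ^ 4 := by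
            gcongr
            · norm_num
        _ = _ := by ring
    rw [e]
    calc _ ≤ ∑ i : Fin k, ∑ j : Fin k, 4 * D * c ^ 2 * r * s * n ^ 4 :=
          (Finset.abs_sum_le_sum_abs _ _).trans (Finset.sum_le_sum fun i _ =>
            (Finset.abs_sum_le_sum_abs _ _).trans (Finset.sum_le_sum fun j _ => hij i j))
      _ = _ := by simp; ring
  have htt : s ^ 2 * |T (0, 1) (0, 1)| ≤ D * s * s * n ^ 4 := by
    have h01 : ‖((0, 1) : (Fin k → ℝ) × ℝ)‖ ≤ 1 := by simp [Prod.norm_def]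
    have h4 : 1 ≤ n ^ 4 := one_le_pow₀ hn
    calc s ^ 2 * |T (0, 1) (0, 1)| ≤ s ^ 2 * D * 1 := by
          rw [mul_one]; gcongr; exact hTb _ _ h01 h01
      _ ≤ s ^ 2 * D * n ^ 4 := by gcongr
      _ = _ := by ring
  have hlin : ∑ i, δ i * (L (Pi.single i 1, 0)
        - s / 2 * (T (Pi.single i 1, 0) (0, 1) + T (0, 1) (Pi.single i 1, 0)))
      = ∑ i, δ i * L (Pi.single i 1, 0)
        - s / 2 * ∑ i, δ i * (T (Pi.single i 1, 0) (0, 1) + T (0, 1) (Pi.single i 1, 0)) := by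
    rw [Finset.mul_sum, ← Finset.sum_sub_distrib]
    exact Finset.sum_congr rfl fun i _ => by ring
  rw [hlin]
  have hG1 := (abs_le.1 (hG.trans hrem)).1
  rw [eL, eT] at hG1
  have hq1 := (abs_le.1 hquad).1
  have ht1 : -(D * s * s * n ^ 4) ≤ s ^ 2 * T (0, 1) (0, 1) := by
    have := mul_le_mul_of_nonneg_left (neg_abs_le (T (0, 1) (0, 1))) (sq_nonneg s)
    linarith
  have hpos : 0 ≤ D * s * s * n ^ 4 := by positivity
  linarith

end step

section integrated

variable {k : ℕ}

lemma abs_apply_le_one_add_norm (y : EuclideanSpace ℝ (Fin k)) (i : Fin k) :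
    |y i| ≤ 1 + ‖y‖ := by
  have := PiLp.norm_apply_le y i
  rw [Real.norm_eq_abs] at this
  linarith

/-- The one-step estimate integrated against a centered Gaussian increment. -/
lemma taylor_step_integral {μ : Measure (EuclideanSpace ℝ (Fin k))} [IsGaussian μ]
    {A : Matrix (Fin k) (Fin k) ℝ} (hcov : ∀ i j, ∫ y, y i * y j ∂μ = A i j)
    (L : (Fin k → ℝ) × ℝ →L[ℝ] ℝ)
    (T : (Fin k → ℝ) × ℝ →L[ℝ] (Fin k → ℝ) × ℝ →L[ℝ] ℝ) {G₀ η C D c r s : ℝ}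
    {w : Fin k → ℝ} {G₁ : EuclideanSpace ℝ (Fin k) → ℝ}
    {δ : EuclideanSpace ℝ (Fin k) → Fin k → ℝ} (hη : 0 ≤ η) (hC : 0 ≤ C) (hT : ‖T‖ ≤ D)
    (hc : 1 ≤ c) (hr : 0 ≤ r) (hs : 0 ≤ s) (hs1 : s ≤ 1) (hrs : r ^ 2 ≤ 2 * s)
    (hG₁ : Integrable G₁ μ)
    (hG : ∀ y, |G₁ y - G₀ - L (δ y, -s) - T (δ y, -s) (δ y, -s) / 2|
      ≤ (η + C * ‖((δ y, -s) : (Fin k → ℝ) × ℝ)‖ ^ 2) * ‖((δ y, -s) : (Fin k → ℝ) × ℝ)‖ ^ 2)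
    (hw : ∀ i, |w i| ≤ c) (hδi : ∀ i, Integrable (fun y => δ y i) μ)
    (hδ0 : ∀ i, ∫ y, δ y i ∂μ = 0)
    (hδ : ∀ y i, |δ y i| ≤ c * r * (1 + ‖y‖))
    (hδw : ∀ y i, |δ y i - r * w i * y i| ≤ c * r ^ 2 * (1 + ‖y‖) ^ 2) :
    G₀ - s * L (0, 1)
      + r ^ 2 / 2 * ∑ i, ∑ j, T (Pi.single i 1, 0) (Pi.single j 1, 0) * (w i * w j) * A i j
      - (2 * k ^ 2 * D * c ^ 2 * r + D * s + 3 * c ^ 2 * η + 9 * C * c ^ 4 * s) * s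
        * ∫ y, (1 + ‖y‖) ^ 4 ∂μ ≤ ∫ y, G₁ y ∂μ := by
  have hpt := fun y => taylor_step_pointwise L T (G₀ := G₀) (n := 1 + ‖y‖) (w := w)
    (y := fun i => y i) hη hC hT hc hr hs hs1 hrs (by linarith [norm_nonneg y]) (hG y)
    (abs_apply_le_one_add_norm y) hw (hδ y) (hδw y)
  have h4 := integrable_one_add_norm_pow μ 4
  have hcoord : ∀ i, MemLp (fun y : EuclideanSpace ℝ (Fin k) => y i) 2 μ := fun i =>
    (memLp_one_add_norm μ (p := 2) (by simp)).mono (by fun_prop)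
      (ae_of_all _ fun y => (abs_apply_le_one_add_norm y i).trans (le_abs_self _))
  have hij : ∀ i j, Integrable (fun y : EuclideanSpace ℝ (Fin k) => y i * y j) μ := fun i j =>
    (hcoord i).integrable_mul (hcoord j)
  have i1 : Integrable (fun y => ∑ i, δ y i * (L (Pi.single i 1, 0)
        - s / 2 * (T (Pi.single i 1, 0) (0, 1) + T (0, 1) (Pi.single i 1, 0)))) μ :=
    integrable_finsetSum _ fun i _ => (hδi i).mul_const _
  have i2 : Integrable (fun y : EuclideanSpace ℝ (Fin k) => ∑ i, ∑ j,
      T (Pi.single i 1, 0) (Pi.single j 1, 0) * (w i * w j) * (y i * y j)) μ :=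
    integrable_finsetSum _ fun i _ => integrable_finsetSum _ fun j _ => (hij i j).const_mul _
  -- The first-order terms and the mixed space-time second-order terms are linear in `δ`, so they
  -- vanish exactly because `δ` has mean zero.
  have e1 : ∫ y, ∑ i, δ y i * (L (Pi.single i 1, 0)
        - s / 2 * (T (Pi.single i 1, 0) (0, 1) + T (0, 1) (Pi.single i 1, 0))) ∂μ = 0 := by
    rw [integral_finsetSum _ fun i _ => (hδi i).mul_const _]
    refine Finset.sum_eq_zero fun i _ => ?_
    rw [integral_mul_const, hδ0, zero_mul]
  have e2 : ∫ y : EuclideanSpace ℝ (Fin k), ∑ i, ∑ j,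
      T (Pi.single i 1, 0) (Pi.single j 1, 0) * (w i * w j) * (y i * y j) ∂μ
      = ∑ i, ∑ j, T (Pi.single i 1, 0) (Pi.single j 1, 0) * (w i * w j) * A i j := by
    rw [integral_finsetSum _ fun i _ => integrable_finsetSum _ fun j _ => (hij i j).const_mul _]
    refine Finset.sum_congr rfl fun i _ => ?_
    rw [integral_finsetSum _ fun j _ => (hij i j).const_mul _]
    refine Finset.sum_congr rfl fun j _ => ?_
    rw [integral_const_mul, hcov]
  have j1 := (integrable_const (μ := μ) G₀).add i1
  have j2 := j1.sub (integrable_const (μ := μ) (s * L (0, 1)))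
  have j3 := j2.add (i2.const_mul (r ^ 2 / 2))
  have j4 := j3.sub (h4.const_mul
    ((2 * k ^ 2 * D * c ^ 2 * r + D * s + 3 * c ^ 2 * η + 9 * C * c ^ 4 * s) * s))
  have hmono := integral_mono j4 hG₁ hpt
  rw [integral_sub' j3 (h4.const_mul _), integral_add' j2 (i2.const_mul _),
    integral_sub' j1 (integrable_const _), integral_add' (integrable_const _) i1, e1,
    integral_const_mul, integral_const_mul, e2] at hmono
  simpa [integral_const_mul] using hmono

end integrated

/-! ### Invariance of the Gaussian measure and time limits of the semigroup -/

lemma integral_ou_prod {E : Type*} [NormedAddCommGroup E]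
    [InnerProductSpace ℝ E] [MeasurableSpace E] [BorelSpace E] [SecondCountableTopology E]
    [CompleteSpace E] (μ : Measure E) [IsGaussian μ] (h0 : ∫ x, id x ∂μ = 0) {s : ℝ} (hs : 0 ≤ s) :
    (μ.prod μ).map (fun p : E × E => Real.exp (-s) • p.1 + √(1 - Real.exp (-2 * s)) • p.2) = μ := by
  rw [map_smul_add_smul_prod_of_isGaussian μ h0 (exp_neg_sq_add_ouScale_sq hs)]
  simp

lemma tendsto_integral_comp_affine {ι : Type*} {l : Filter ι} [l.IsCountablyGenerated]
    {μ : Measure ℝ} [IsProbabilityMeasure μ] {f : ℝ → ℝ} (hf : Continuous f) {B : ℝ}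
    (hB : ∀ x, |f x| ≤ B) {α β : ι → ℝ} {α₀ β₀ : ℝ} (hα : Tendsto α l (𝓝 α₀))
    (hβ : Tendsto β l (𝓝 β₀)) :
    Tendsto (fun i => ∫ z, f (α i + β i * z) ∂μ) l (𝓝 (∫ z, f (α₀ + β₀ * z) ∂μ)) := by
  refine tendsto_integral_filter_of_dominated_convergence (fun _ => B)
    (Eventually.of_forall fun i => (hf.comp (by fun_prop)).aestronglyMeasurable)
    (Eventually.of_forall fun i => ae_of_all _ fun z => hB _) (integrable_const _)
    (ae_of_all _ fun z => ?_)
  exact (hf.tendsto _).comp (hα.add (hβ.mul_const z))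

lemma continuous_ouSemigroup_time {f : ℝ → ℝ} (hf : Continuous f) {B : ℝ}
    (hB : ∀ x, |f x| ≤ B) (v : ℝ≥0) (x : ℝ) : Continuous fun t => ouSemigroup v t f x := by
  refine continuous_iff_continuousAt.2 fun t => ?_
  have h1 : Continuous fun t : ℝ => Real.exp (-t) * x := by fun_prop
  have h2 : Continuous fun t : ℝ => √(1 - Real.exp (-2 * t)) := by fun_prop
  exact tendsto_integral_comp_affine hf hB (h1.tendsto t) (h2.tendsto t)

lemma tendsto_ouSemigroup_atTop {f : ℝ → ℝ} (hf : Continuous f) {B : ℝ}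
    (hB : ∀ x, |f x| ≤ B) (v : ℝ≥0) (x : ℝ) :
    Tendsto (fun t => ouSemigroup v t f x) atTop (𝓝 (∫ z, f z ∂gaussianReal 0 v)) := by
  have h1 : Tendsto (fun t : ℝ => Real.exp (-t) * x) atTop (𝓝 (0 * x)) :=
    (Real.tendsto_exp_neg_atTop_nhds_zero).mul_const x
  have h2 : Tendsto (fun t : ℝ => √(1 - Real.exp (-2 * t))) atTop (𝓝 √(1 - 0)) := by
    have h3 : Tendsto (fun t : ℝ => Real.exp (-2 * t)) atTop (𝓝 0) := by
      refine Real.tendsto_exp_atBot.comp ?_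
      exact tendsto_id.const_mul_atTop_of_neg (by norm_num)
    exact (Real.continuous_sqrt.tendsto _).comp (h3.const_sub 1)
  have := tendsto_integral_comp_affine (μ := gaussianReal 0 v) hf hB h1 h2
  simp only [zero_mul, sub_zero, Real.sqrt_one, one_mul, zero_add] at this
  exact this

lemma ouSemigroup_const_mul (v : ℝ≥0) (t c : ℝ) (f : ℝ → ℝ) (x : ℝ) :
    ouSemigroup v t (fun y => c * f y) x = c * ouSemigroup v t f x :=
  integral_const_mul _ _

/-! ### One step of the interpolation -/

section flow

variable {k : ℕ} {A : Matrix (Fin k) (Fin k) ℝ} {J : (Fin k → ℝ) → ℝ≥0∞ → ℝ}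
  {Ω : Set (Fin k → ℝ)} {f f' : Fin k → ℝ → ℝ} {c d : Fin k → ℝ} {M ε : ℝ}

/-- The vector `(P_t f_i (x_i))_i`, where `P_t` has stationary variance `A_ii` in the `i`-th
coordinate. -/
noncomputable def ouVector (A : Matrix (Fin k) (Fin k) ℝ) (f : Fin k → ℝ → ℝ) (t : ℝ)
    (x : EuclideanSpace ℝ (Fin k)) (i : Fin k) : ℝ :=
  ouSemigroup (A i i).toNNReal t (f i) (x i)

/-- The interpolation between the two sides of the inequality. -/
noncomputable def interpolant (A : Matrix (Fin k) (Fin k) ℝ) (J : (Fin k → ℝ) → ℝ≥0∞ → ℝ)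
    (f : Fin k → ℝ → ℝ) (ε t : ℝ) : ℝ :=
  ∫ x, J (ouVector A f (t + ε) x) (ENNReal.ofReal t) ∂multivariateGaussian 0 A

lemma abs_le_of_forall_mem_Icc {g : ℝ → ℝ} {c d : ℝ} (h : ∀ x, g x ∈ Icc c d) (x : ℝ) :
    |g x| ≤ max |c| |d| :=
  abs_le_max_abs_abs (h x).1 (h x).2

lemma continuous_comp_of_mem {X : Type*} [TopologicalSpace X]
    (hJc : ContinuousOn (fun p : (Fin k → ℝ) × ℝ≥0∞ => J p.1 p.2) (Ω ×ˢ univ))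
    {u : X → Fin k → ℝ} (hu : Continuous u) (hmem : ∀ x, u x ∈ Ω) (τ : ℝ≥0∞) :
    Continuous fun x => J (u x) τ :=
  hJc.comp_continuous (f := fun x => (u x, τ)) (by fun_prop) fun x => ⟨hmem x, mem_univ _⟩

lemma tendsto_comp_of_mem {X : Type*} {l : Filter X}
    (hJc : ContinuousOn (fun p : (Fin k → ℝ) × ℝ≥0∞ => J p.1 p.2) (Ω ×ˢ univ))
    {u : X → Fin k → ℝ} {τ : X → ℝ≥0∞} {u₀ : Fin k → ℝ} {τ₀ : ℝ≥0∞} (hu : Tendsto u l (𝓝 u₀))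
    (hτ : Tendsto τ l (𝓝 τ₀)) (hmem : ∀ x, u x ∈ Ω) (hmem₀ : u₀ ∈ Ω) :
    Tendsto (fun x => J (u x) (τ x)) l (𝓝 (J u₀ τ₀)) := by
  have h := (hJc (u₀, τ₀) ⟨hmem₀, mem_univ _⟩).tendsto
  refine h.comp (tendsto_nhdsWithin_iff.2 ⟨hu.prodMk_nhds hτ, Eventually.of_forall fun x => ?_⟩)
  exact ⟨hmem x, mem_univ _⟩

lemma continuous_ouVector (hf : ∀ i, TaylorBound (f i) (f' i) M)
    (hfcd : ∀ i z, f i z ∈ Icc (c i) (d i)) {t : ℝ} (ht : 0 ≤ t) :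
    Continuous (ouVector A f t) :=
  continuous_pi fun i =>
    ((hf i).ouSemigroup ht (abs_le_of_forall_mem_Icc (hfcd i))).continuous.comp (by fun_prop)

lemma ouVector_mem (hf : ∀ i, TaylorBound (f i) (f' i) M)
    (hfcd : ∀ i z, f i z ∈ Icc (c i) (d i)) (t : ℝ) (x : EuclideanSpace ℝ (Fin k)) :
    ouVector A f t x ∈ Icc c d :=
  ⟨fun i => (ouSemigroup_mem_Icc (hf i).continuous.measurable (hfcd i) t (x i)).1,
    fun i => (ouSemigroup_mem_Icc (hf i).continuous.measurable (hfcd i) t (x i)).2⟩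

lemma integral_eval_comp_multivariateGaussian (hA : A.PosSemidef) (i : Fin k) {g : ℝ → ℝ}
    (hg : Measurable g) :
    ∫ y, g (y i) ∂multivariateGaussian 0 A = ∫ z, g z ∂gaussianReal 0 (A i i).toNNReal := by
  have h := measurePreserving_eval_multivariateGaussian (μ := 0) hA (i := i)
  have h2 : gaussianReal 0 (A i i).toNNReal = (multivariateGaussian 0 A).map (fun x => x i) := by
    rw [h.map_eq]; simp
  rw [h2, integral_map h.measurable.aemeasurable hg.aestronglyMeasurable]

lemma integral_mul_multivariateGaussian (hA : A.PosSemidef) (i j : Fin k) :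
    ∫ y, y i * y j ∂multivariateGaussian 0 A = A i j := by
  have h0 : ∀ i : Fin k, ∫ y, y i ∂multivariateGaussian 0 A = 0 := fun i => by
    rw [integral_eval_comp_multivariateGaussian hA i measurable_id']
    exact integral_id_gaussianReal
  have hL : ∀ i : Fin k, MemLp (fun y : EuclideanSpace ℝ (Fin k) => y i) 2
      (multivariateGaussian 0 A) := fun i =>
    (memLp_one_add_norm _ (p := 2) (by simp)).mono (by fun_prop)
      (ae_of_all _ fun y => (abs_apply_le_one_add_norm y i).trans (le_abs_self _))
  have h := covariance_eval_multivariateGaussian (μ := 0) hA i j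
  rw [covariance_eq_sub (hL i) (hL j), h0, zero_mul, sub_zero] at h
  exact h

lemma ouScale_sq_le {s : ℝ} (hs : 0 ≤ s) : √(1 - Real.exp (-2 * s)) ^ 2 ≤ 2 * s := by
  rw [ouScale_sq hs]
  linarith [Real.add_one_le_exp (-2 * s)]

/-- Fubini form of the invariance of the Gaussian measure under the Ornstein-Uhlenbeck kernel. -/
lemma integral_integral_ou {μ : Measure (EuclideanSpace ℝ (Fin k))} [IsGaussian μ]
    (h0 : ∫ x, id x ∂μ = 0) {s : ℝ} (hs : 0 ≤ s) {Φ : EuclideanSpace ℝ (Fin k) → ℝ}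
    (hΦ : Continuous Φ) {B : ℝ} (hB : ∀ x, |Φ x| ≤ B) :
    Integrable (fun x => ∫ y, Φ (Real.exp (-s) • x + √(1 - Real.exp (-2 * s)) • y) ∂μ) μ ∧
    ∫ x, Φ x ∂μ
      = ∫ x, ∫ y, Φ (Real.exp (-s) • x + √(1 - Real.exp (-2 * s)) • y) ∂μ ∂μ := by
  have hi : Integrable (fun p : EuclideanSpace ℝ (Fin k) × EuclideanSpace ℝ (Fin k) =>
      Φ (Real.exp (-s) • p.1 + √(1 - Real.exp (-2 * s)) • p.2)) (μ.prod μ) :=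
    integrable_of_abs_le (hΦ.comp (by fun_prop)).aestronglyMeasurable fun _ => hB _
  refine ⟨hi.integral_prod_left, ?_⟩
  rw [← integral_prod _ hi, ← integral_map (μ := μ.prod μ)
    (φ := fun p : EuclideanSpace ℝ (Fin k) × EuclideanSpace ℝ (Fin k) =>
      Real.exp (-s) • p.1 + √(1 - Real.exp (-2 * s)) • p.2) (f := Φ) (by fun_prop)
      hΦ.aestronglyMeasurable, integral_ou_prod μ h0 hs]

set_option maxHeartbeats 1000000 in
/-- One step of the flow decreases the interpolant up to an error `o(s)`, uniformly on compact
time intervals. -/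
lemma eventually_interpolant_step (hA : A.PosSemidef) (hΩ : IsOpen Ω)
    (hJ_bdd : ∃ C : ℝ, ∀ x ∈ Ω, ∀ t : ℝ≥0∞, |J x t| ≤ C)
    (hJc : ContinuousOn (fun p : (Fin k → ℝ) × ℝ≥0∞ => J p.1 p.2) (Ω ×ˢ univ))
    (hJ2 : ContDiffOn ℝ 2 (realTime J) (Ω ×ˢ Ioi (0 : ℝ)))
    {lam : Fin k → ℝ} (hlam : ∀ i, 0 ≤ lam i) (hsum : ∑ i, lam i = 1) (hε : 0 ≤ ε)
    (hJ_time : ∀ x ∈ Ω, ∀ t : ℝ, 0 < t → timeDeriv J x t ≤ 0)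
    (hJ_hess : ∀ x ∈ Ω, ∀ t : ℝ, 0 < t →
      (A ⊙ hessianMatrix (fun y => J y (ENNReal.ofReal t)) x
        - ((Real.exp (2 * (t + ε)) - 1) * timeDeriv J x t) • weightMatrix A lam x).PosSemidef)
    (hf : ∀ i, TaylorBound (f i) (f' i) M) (hder : ∀ i x, HasDerivAt (f i) (f' i x) x)
    (hfcd : ∀ i z, f i z ∈ Icc (c i) (d i)) (hcd : Icc c d ⊆ Ω)
    (hc0 : ∀ i, 0 < c i) (hd1 : ∀ i, d i < 1) {t₀ t₁ : ℝ} (ht₀ : 0 < t₀) {ω : ℝ} (hω : 0 < ω) :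
    ∀ᶠ s in 𝓝[>] (0 : ℝ), ∀ t, t₀ ≤ t → t + s ≤ t₁ →
      interpolant A J f ε (t + s) - ω * s ≤ interpolant A J f ε t := by
  obtain ⟨B, hB⟩ := hJ_bdd
  -- A negative `M` would leave no coordinates, contradicting `∑ λ_i = 1`.
  have hM : 0 ≤ M := by
    by_contra hneg
    have : IsEmpty (Fin k) := ⟨fun i => hneg (hf i).nonneg⟩
    simp at hsum
  set μ := multivariateGaussian 0 A with hμ
  have hμ0 : ∫ x, id x ∂μ = 0 := integral_id_multivariateGaussian'
  set K : Set ((Fin k → ℝ) × ℝ) := Icc c d ×ˢ Icc t₀ t₁ with hKdef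
  have hU : IsOpen (Ω ×ˢ Ioi (0 : ℝ)) := hΩ.prod isOpen_Ioi
  have hKU : K ⊆ Ω ×ˢ Ioi (0 : ℝ) := prod_mono hcd fun t ht => ht₀.trans_le ht.1
  have hK : IsCompact K := isCompact_Icc.prod isCompact_Icc
  have hKc : Convex ℝ K := (convex_Icc c d).prod (convex_Icc t₀ t₁)
  have hT : ContinuousOn (fderiv ℝ (fderiv ℝ (realTime J))) (Ω ×ˢ Ioi (0 : ℝ)) :=
    (hJ2.fderiv_of_isOpen hU (m := 1) (by norm_num)).continuousOn_fderiv_of_isOpen hU (by norm_num)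
  obtain ⟨D, hD⟩ := hK.exists_bound_of_continuousOn
    (E := (Fin k → ℝ) × ℝ →L[ℝ] (Fin k → ℝ) × ℝ →L[ℝ] ℝ) (hT.mono hKU)
  set κ := ∫ y, (1 + ‖y‖) ^ 4 ∂μ with hκ
  have hκ0 : 0 ≤ κ := integral_nonneg fun y => by positivity
  -- One constant dominates `1`, `M` and all the fluctuation constants `M * gaussMoment`.
  set b := 1 + M * (1 + ∑ i, gaussMoment (A i i).toNNReal) with hbdef
  have hsm : ∀ i, gaussMoment (A i i).toNNReal ≤ ∑ i, gaussMoment (A i i).toNNReal := fun i =>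
    Finset.single_le_sum (f := fun i => gaussMoment (A i i).toNNReal)
      (fun j _ => zero_le_one.trans (one_le_gaussMoment _)) (Finset.mem_univ i)
  have hsm0 : 0 ≤ ∑ i, gaussMoment (A i i).toNNReal :=
    Finset.sum_nonneg fun j _ => zero_le_one.trans (one_le_gaussMoment _)
  have hb1 : 1 ≤ b := by
    have : 0 ≤ M * (1 + ∑ i, gaussMoment (A i i).toNNReal) := mul_nonneg hM (by linarith)
    linarith
  have hMb : M ≤ b := by nlinarith
  have hMκ : ∀ i, M * gaussMoment (A i i).toNNReal ≤ b := fun i => by nlinarith [hsm i]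
  -- The only error rate that does not vanish with `s` is `3 b² η κ`. This choice makes it at most
  -- `ω / 2`, and small `s` makes the rest less than `ω / 2`.
  set η := ω / (6 * b ^ 2 * (κ + 1)) with hη
  have hη0 : 0 < η := by positivity
  obtain ⟨C, hC0, hC⟩ := exists_taylor_two_bound hU hKU hK hKc hJ2 hη0
  have hηω : 3 * b ^ 2 * η * κ ≤ ω / 2 := by
    have : 3 * b ^ 2 * η * (κ + 1) = ω / 2 := by rw [hη]; field_simp; norm_num
    have : 0 ≤ 3 * b ^ 2 * η := by positivity
    nlinarith
  have hlim : Tendsto (fun s : ℝ => (2 * k ^ 2 * D * b ^ 2 * √(1 - Real.exp (-2 * s)) + D * s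
      + 9 * C * b ^ 4 * s) * κ) (𝓝[>] 0) (𝓝 0) := by
    have h : Continuous fun s : ℝ => (2 * k ^ 2 * D * b ^ 2 * √(1 - Real.exp (-2 * s)) + D * s
      + 9 * C * b ^ 4 * s) * κ := by fun_prop
    have h2 := h.tendsto 0
    simp only [mul_zero, Real.exp_zero, sub_self, Real.sqrt_zero, add_zero, zero_mul] at h2
    exact h2.mono_left nhdsWithin_le_nhds
  filter_upwards [hlim.eventually_lt_const (half_pos hω), self_mem_nhdsWithin,
    Ioo_mem_nhdsGT (zero_lt_one (α := ℝ))] with s hsω hs0 hs1 t ht hts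
  have hs0' : 0 ≤ s := le_of_lt hs0
  set r := √(1 - Real.exp (-2 * s)) with hr
  have htε : 0 ≤ t + ε := by linarith
  have htsε : 0 ≤ t + s + ε := by linarith
  have hg : ∀ i, TaylorBound (ouSemigroup (A i i).toNNReal (t + ε) (f i))
      (fun x => Real.exp (-(t + ε)) * ouSemigroup (A i i).toNNReal (t + ε) (f' i) x) M :=
    fun i => (hf i).ouSemigroup htε (abs_le_of_forall_mem_Icc (hfcd i))
  have hgcd : ∀ i z, ouSemigroup (A i i).toNNReal (t + ε) (f i) z ∈ Icc (c i) (d i) := fun i z =>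
    ouSemigroup_mem_Icc (hf i).continuous.measurable (hfcd i) _ _
  have hV := fun τ x => ouVector_mem (A := A) hf hfcd τ x
  have hΦc : Continuous fun x => J (ouVector A f (t + ε) x) (ENNReal.ofReal t) :=
    continuous_comp_of_mem hJc (continuous_ouVector hf hfcd htε) (fun x => hcd (hV _ x)) _
  have hΦB : ∀ x, |J (ouVector A f (t + ε) x) (ENNReal.ofReal t)| ≤ B := fun x =>
    hB _ (hcd (hV _ x)) _
  have hΨc : Continuous fun x => J (ouVector A f (t + s + ε) x) (ENNReal.ofReal (t + s)) :=
    continuous_comp_of_mem hJc (continuous_ouVector hf hfcd htsε) (fun x => hcd (hV _ x)) _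
  obtain ⟨hi, he⟩ := integral_integral_ou hμ0 hs0' hΦc hΦB
  have hΨi : Integrable (fun x => J (ouVector A f (t + s + ε) x) (ENNReal.ofReal (t + s))) μ :=
    integrable_of_abs_le hΨc.aestronglyMeasurable (B := B) fun x => hB _ (hcd (hV _ x)) _
  -- The step holds conditionally on `x`. The expansion is based at the later time `t + s` and at
  -- `m`, the mean over `y` of the random position, and goes back by `s` in time.
  have hmain : ∀ x, J (ouVector A f (t + s + ε) x) (ENNReal.ofReal (t + s)) - ω * s
      ≤ ∫ y, J (ouVector A f (t + ε) (Real.exp (-s) • x + r • y)) (ENNReal.ofReal t) ∂μ := by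
    intro x
    set m := ouVector A f (t + s + ε) x with hm
    set p : (Fin k → ℝ) × ℝ := (m, t + s) with hp
    have hpK : p ∈ K := ⟨hV _ x, by linarith, hts⟩
    have hts0 : 0 < t + s := by linarith [mem_Ioi.1 hs0]
    have hmi : ∀ i, m i
        = ouSemigroup (A i i).toNNReal s (ouSemigroup (A i i).toNNReal (t + ε) (f i)) (x i) :=
      fun i => by
        rw [ouSemigroup_ouSemigroup (hf i).continuous.measurable
          (abs_le_of_forall_mem_Icc (hfcd i)) hs0' htε, hm, ouVector]
        congr 1; ring
    set w : Fin k → ℝ := fun i => Real.exp (-s) * ouSemigroup (A i i).toNNReal s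
      (fun x => Real.exp (-(t + ε)) * ouSemigroup (A i i).toNNReal (t + ε) (f' i) x) (x i) with hw
    -- The slope of the linearised increment is the derivative of `P_{t+s+ε} f_i` at `x_i`, the
    -- quantity controlled by the gradient bound.
    have hwi : ∀ i, w i = Real.exp (-(t + s + ε))
        * ouSemigroup (A i i).toNNReal (t + s + ε) (f' i) (x i) := fun i => by
      rw [hw]
      simp only []
      rw [ouSemigroup_const_mul, ouSemigroup_ouSemigroup (hf i).continuous'.measurable
        (hf i).bdd' hs0' htε, ← mul_assoc, ← Real.exp_add]
      congr 2 <;> ring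
    have hwM : ∀ i, |w i| ≤ M := fun i => ((hg i).ouSemigroup hs0'
      (abs_le_of_forall_mem_Icc (hgcd i))).bdd' (x i)
    set δ : EuclideanSpace ℝ (Fin k) → Fin k → ℝ := fun y i =>
      ouVector A f (t + ε) (Real.exp (-s) • x + r • y) i - m i with hδ
    have hVi : ∀ y i, ouVector A f (t + ε) (Real.exp (-s) • x + r • y) i
        = ouSemigroup (A i i).toNNReal (t + ε) (f i) (Real.exp (-s) * x i + r * y i) :=
      fun y i => by simp [ouVector]
    have hpδ : ∀ y, p + (δ y, -s)
        = (ouVector A f (t + ε) (Real.exp (-s) • x + r • y), t) := fun y => by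
      refine Prod.ext ?_ ?_
      · ext i; simp [hp, hδ]
      · simp [hp]
    have hcontV : Continuous fun y => ouVector A f (t + ε) (Real.exp (-s) • x + r • y) :=
      (continuous_ouVector hf hfcd htε).comp (by fun_prop)
    have hVint : ∀ i, Integrable
        (fun y => ouVector A f (t + ε) (Real.exp (-s) • x + r • y) i) μ := fun i =>
      integrable_of_abs_le ((continuous_apply i).comp hcontV).aestronglyMeasurable
        fun y => abs_le_max_abs_abs ((hV _ _).1 i) ((hV _ _).2 i)
    have hstep := taylor_step_integral (μ := μ) (A := A) (integral_mul_multivariateGaussian hA)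
      (fderiv ℝ (realTime J) p) (fderiv ℝ (fderiv ℝ (realTime J)) p) (G₀ := realTime J p)
      (η := η) (C := C) (D := D) (c := b) (r := r) (s := s) (w := w) (δ := δ)
      (G₁ := fun y => J (ouVector A f (t + ε) (Real.exp (-s) • x + r • y)) (ENNReal.ofReal t))
      hη0.le hC0 (hD p hpK) hb1 (Real.sqrt_nonneg _) hs0' hs1.2.le (ouScale_sq_le hs0')
      (integrable_of_abs_le (hΦc.comp (by fun_prop)).aestronglyMeasurable fun y => hΦB _)
      (fun y => by
        have := hC p hpK (δ y, -s) (by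
          rw [hpδ]; exact ⟨hV _ _, ht, by linarith⟩)
        rw [hpδ] at this
        exact this)
      (fun i => (hwM i).trans hMb)
      (fun i => (hVint i).sub (integrable_const _))
      (fun i => by
        simp only [hδ]
        rw [integral_sub (hVint i) (integrable_const _), integral_const, hmi]
        simp only [hVi]
        rw [integral_eval_comp_multivariateGaussian hA i
          (g := fun z => ouSemigroup (A i i).toNNReal (t + ε) (f i) (Real.exp (-s) * x i + r * z))
          ((hg i).continuous.measurable.comp (by fun_prop))]
        simp [ouSemigroup, hr])
      (fun y i => by
        simp only [hδ]
        rw [hVi, hmi]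
        refine ((hg i).abs_fluctuation_le (abs_le_of_forall_mem_Icc (hgcd i)) _ _).trans ?_
        have := PiLp.norm_apply_le y i
        rw [Real.norm_eq_abs] at this
        have hr0 : 0 ≤ r := Real.sqrt_nonneg _
        gcongr
        exact hMκ i)
      (fun y i => by
        simp only [hδ]
        rw [hVi, hmi]
        refine ((hg i).abs_fluctuation_sub_linear_le (abs_le_of_forall_mem_Icc (hgcd i)) hs0'
          _ _).trans ?_
        have := PiLp.norm_apply_le y i
        rw [Real.norm_eq_abs] at this
        gcongr
        exact hMκ i)
    have hdiff : DifferentiableAt ℝ (realTime J) p :=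
      (hJ2.differentiableOn (by norm_num)).differentiableAt (hU.mem_nhds (hKU hpK))
    have hmΩ : m ∈ Ω := hcd (hV _ x)
    have hτ := hJ_time m hmΩ (t + s) hts0
    have hS := timeDeriv_le_of_posSemidef (w := w) hlam hsum hτ (hJ_hess m hmΩ (t + s) hts0)
      (fun i => by
        have hAi : ((A i i).toNNReal : ℝ) = A i i := Real.coe_toNNReal _ hA.diag_nonneg
        have := ouSemigroup_gradient_bound (v := (A i i).toNNReal) (hder i)
          (hf i).continuous'.measurable (hf i).bdd'
          (fun z => ⟨(hc0 i).le.trans (hfcd i z).1, (hfcd i z).2.trans (hd1 i).le⟩) htsε (x i)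
          ⟨(hc0 i).trans_le ((hV _ x).1 i), ((hV _ x).2 i).trans_lt (hd1 i)⟩
        rw [hAi] at this
        rw [hwi]
        exact this)
    have hS' : ∑ i, ∑ j, fderiv ℝ (fderiv ℝ (realTime J)) p (Pi.single i 1, 0) (Pi.single j 1, 0)
        * (w i * w j) * A i j = ∑ i, ∑ j, A i j
          * hessianMatrix (fun y => J y (ENNReal.ofReal (t + s))) m i j * (w i * w j) :=
      Finset.sum_congr rfl fun i _ => Finset.sum_congr rfl fun j _ => by
        rw [hessianMatrix_eq hΩ hJ2 hmΩ hts0]; ring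
    rw [hS', ← timeDeriv_eq hdiff] at hstep
    have hr2 := ouScale_sq_le hs0'
    rw [← hr] at hr2
    -- Since the time derivative is nonpositive and `r² ≤ 2s`, replacing `s` by `r² / 2` increases
    -- the left side; then `hS` applies.
    have hgain : s * timeDeriv J m (t + s) ≤ r ^ 2 / 2 * ∑ i, ∑ j, A i j
          * hessianMatrix (fun y => J y (ENNReal.ofReal (t + s))) m i j * (w i * w j) := by
      have h1 := mul_le_mul_of_nonneg_left hS (by positivity : 0 ≤ r ^ 2 / 2)
      nlinarith
    have herr : (2 * k ^ 2 * D * b ^ 2 * r + D * s + 3 * b ^ 2 * η + 9 * C * b ^ 4 * s) * s * κ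
        ≤ ω * s := by
      have : (2 * k ^ 2 * D * b ^ 2 * r + D * s + 3 * b ^ 2 * η + 9 * C * b ^ 4 * s) * κ ≤ ω := by
        linarith
      nlinarith
    have e0 : realTime J p = J m (ENNReal.ofReal (t + s)) := rfl
    rw [e0] at hstep
    linarith
  have := integral_mono (hΨi.sub (integrable_const (ω * s))) hi hmain
  rw [integral_sub' hΨi (integrable_const _), ← he, integral_const] at this
  simpa [interpolant] using this

end flow

/-! ### From small steps to monotonicity -/

/-- Over a fine equal subdivision the errors add up to `ω (t₁ - t₀)`, and `ω` is arbitrary. No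
continuity of `F` is needed, because the threshold for `s` is uniform in `t`. -/
lemma le_of_eventually_step {F : ℝ → ℝ} {t₀ t₁ : ℝ} (h01 : t₀ < t₁)
    (h : ∀ ω : ℝ, 0 < ω → ∀ᶠ s in 𝓝[>] (0 : ℝ), ∀ t, t₀ ≤ t → t + s ≤ t₁ →
      F (t + s) - ω * s ≤ F t) : F t₁ ≤ F t₀ := by
  have key : ∀ ω : ℝ, 0 < ω → F t₁ ≤ F t₀ + ω * (t₁ - t₀) := by
    intro ω hω
    have hlim : Tendsto (fun n : ℕ => (t₁ - t₀) / ((n : ℝ) + 1)) atTop (𝓝[>] 0) := by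
      refine tendsto_nhdsWithin_iff.2 ⟨?_, Eventually.of_forall fun n => ?_⟩
      · have := (tendsto_one_div_add_atTop_nhds_zero_nat (𝕜 := ℝ)).const_mul (t₁ - t₀)
        simpa [div_eq_mul_inv] using this
      · exact div_pos (sub_pos.2 h01) (by positivity)
    obtain ⟨n, hn⟩ := (hlim.eventually (h ω hω)).exists
    set s := (t₁ - t₀) / ((n : ℝ) + 1) with hs
    have hs0 : 0 < s := div_pos (sub_pos.2 h01) (by positivity)
    have hns : ((n : ℝ) + 1) * s = t₁ - t₀ := by rw [hs]; field_simp
    have hj : ∀ j : ℕ, j ≤ n + 1 → F (t₀ + j * s) ≤ F t₀ + ω * (j * s) := by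
      intro j
      induction j with
      | zero => intro _; simp
      | succ j ih =>
        intro hjn
        have h1 := ih (by omega)
        have hjn' : ((j : ℝ) + 1) ≤ n + 1 := by exact_mod_cast hjn
        have h2 := hn (t₀ + j * s) (by nlinarith [(Nat.cast_nonneg j : (0 : ℝ) ≤ j)]) (by nlinarith)
        push_cast
        rw [show t₀ + ((j : ℝ) + 1) * s = t₀ + j * s + s by ring]
        linarith
    have h3 := hj (n + 1) le_rfl
    push_cast at h3
    rw [hns] at h3
    simpa using h3
  refine le_of_forall_pos_le_add fun e he => ?_
  have := key (e / (t₁ - t₀)) (div_pos he (sub_pos.2 h01))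
  rwa [div_mul_cancel₀ _ (sub_pos.2 h01).ne'] at this

/-! ### Smooth approximation -/

namespace TaylorBound

variable {g g' : ℝ → ℝ} {M N : ℝ}

lemma mono (h : TaylorBound g g' M) (hMN : M ≤ N) : TaylorBound g g' N where
  lip u w := (h.lip u w).trans (mul_le_mul_of_nonneg_right hMN (abs_nonneg _))
  lip' u w := (h.lip' u w).trans (mul_le_mul_of_nonneg_right hMN (abs_nonneg _))
  bdd' u := (h.bdd' u).trans hMN
  quad u k := (h.quad u k).trans (mul_le_mul_of_nonneg_right hMN (sq_nonneg _))

lemma abs_sub_le_of_hasDerivAt (h : ∀ x, HasDerivAt g (g' x) x) (hM : ∀ x, |g' x| ≤ M)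
    (u w : ℝ) : |g u - g w| ≤ M * |u - w| :=
  convex_univ.norm_image_sub_le_of_norm_hasDerivWithin_le (f := g) (f' := g')
    (fun x _ => (h x).hasDerivWithinAt) (fun x _ => hM x) (mem_univ w) (mem_univ u)

lemma of_hasDerivAt {g'' : ℝ → ℝ} (h : ∀ x, HasDerivAt g (g' x) x)
    (h' : ∀ x, HasDerivAt g' (g'' x) x) (hM : ∀ x, |g' x| ≤ M) (hM' : ∀ x, |g'' x| ≤ M) :
    TaylorBound g g' M where
  lip := abs_sub_le_of_hasDerivAt h hM
  lip' := abs_sub_le_of_hasDerivAt h' hM'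
  bdd' := hM
  quad u k := by
    -- Between `0` and `k` this derivative is at most `M |k|`, so the mean value inequality gives `M
    -- k²`.
    have h1 : ∀ y, HasDerivAt (fun y => g (u + y) - g' u * y) (g' (u + y) - g' u) y := fun y => by
      have h2 := (h (u + y)).comp_const_add u y
      have h3 := (hasDerivAt_id y).const_mul (g' u)
      exact (h2.sub h3).congr_deriv (by simp)
    have h4 := (convex_uIcc (0 : ℝ) k).norm_image_sub_le_of_norm_hasDerivWithin_le
      (f := fun y => g (u + y) - g' u * y) (f' := fun y => g' (u + y) - g' u) (C := M * |k|)
      (x := 0) (y := k)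
      (fun y _ => (h1 y).hasDerivWithinAt) (fun y hy => by
        refine (abs_sub_le_of_hasDerivAt h' hM' _ _).trans ?_
        rw [add_sub_cancel_left]
        refine mul_le_mul_of_nonneg_left ?_ ((abs_nonneg _).trans (hM 0))
        simpa using abs_sub_left_of_mem_uIcc hy) left_mem_uIcc right_mem_uIcc
    simp only [add_zero, mul_zero, sub_zero, Real.norm_eq_abs] at h4
    rw [mul_assoc, abs_mul_abs_self, ← pow_two] at h4
    rwa [sub_right_comm] at h4

lemma exists_of_contDiff_hasCompactSupport {h : ℝ → ℝ} (hh : ContDiff ℝ 2 h)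
    (hs : HasCompactSupport h) (m : ℝ) :
    (∀ x, HasDerivAt (fun x => m + h x) (deriv h x) x) ∧
      ∃ M, TaylorBound (fun x => m + h x) (deriv h) M := by
  have h1 : ContDiff ℝ 1 (deriv h) := (contDiff_succ_iff_deriv (n := 1)).1 hh |>.2.2
  have h2 : Continuous (deriv (deriv h)) := h1.continuous_deriv le_rfl
  have d1 : ∀ x, HasDerivAt (fun x => m + h x) (deriv h x) x := fun x =>
    ((hh.differentiable (by norm_num)) x).hasDerivAt.const_add m
  have d2 : ∀ x, HasDerivAt (deriv h) (deriv (deriv h) x) x := fun x =>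
    ((h1.differentiable (by norm_num)) x).hasDerivAt
  obtain ⟨M1, hM1⟩ := hs.deriv.exists_bound_of_continuous h1.continuous
  obtain ⟨M2, hM2⟩ := hs.deriv.deriv.exists_bound_of_continuous h2
  exact ⟨d1, max M1 M2, of_hasDerivAt d1 d2 (fun x => (hM1 x).trans (le_max_left _ _))
    fun x => (hM2 x).trans (le_max_right _ _)⟩

end TaylorBound

/-- The clamp of `x` to `[-ρ, ρ]`. -/
def clamp (ρ x : ℝ) : ℝ := max (-ρ) (min ρ x)

lemma continuous_clamp (ρ : ℝ) : Continuous (clamp ρ) := by unfold clamp; fun_prop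

lemma abs_clamp_le {ρ : ℝ} (hρ : 0 ≤ ρ) (x : ℝ) : |clamp ρ x| ≤ ρ :=
  abs_le.2 ⟨le_max_left _ _, max_le (by linarith) (min_le_left _ _)⟩

lemma clamp_zero {ρ : ℝ} (hρ : 0 ≤ ρ) : clamp ρ 0 = 0 := by simp [clamp, hρ]

/-- Clamping would not increase the distance to a point of `[-ρ, ρ]`; a point exceeding that
interval by at most `σ` costs at most `σ` more. -/
lemma abs_sub_clamp_le {ρ σ x y : ℝ} (hσ : 0 ≤ σ) (hρ : 0 ≤ ρ) (hy : |y| ≤ ρ + σ) :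
    |y - clamp ρ x| ≤ |y - x| + σ := by
  have := abs_le.1 hy
  have h1 := le_abs_self (y - x)
  have h2 := neg_abs_le (y - x)
  unfold clamp
  rw [abs_le]
  rcases le_total ρ x with h | h
  · rw [min_eq_left h, max_eq_right (by linarith)]
    constructor <;> linarith
  · rw [min_eq_right h]
    rcases le_total (-ρ) x with h' | h'
    · rw [max_eq_right h']
      constructor <;> linarith
    · rw [max_eq_left h']
      constructor <;> linarith

/-- A bounded measurable function is approximated in `L¹` by a smooth, compactly supported one
obeying a slightly stronger bound. -/
lemma exists_smooth_approx {μ : Measure ℝ} [IsProbabilityMeasure μ] {h : ℝ → ℝ}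
    (hh : Measurable h) {r : ℝ} (hr : 0 < r) (hhr : ∀ x, |h x| ≤ r) {e : ℝ} (he : 0 < e) :
    ∃ g : ℝ → ℝ, ContDiff ℝ 2 g ∧ HasCompactSupport g ∧ (∃ ρ < r, ∀ x, |g x| ≤ ρ) ∧
      ∫ x, |h x - g x| ∂μ ≤ e := by
  -- Clamping at `r - 2σ` and then smoothing within `σ` leaves a margin `σ` below `r`. The `L¹`
  -- error is at most `e/2 + 2σ + σ ≤ e`.
  set σ := min (e / 6) (r / 3) with hσ
  have hσ0 : 0 < σ := lt_min (by positivity) (by positivity)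
  have hσe : σ ≤ e / 6 := min_le_left _ _
  have hσr : σ ≤ r / 3 := min_le_right _ _
  have hρ : 0 ≤ r - 2 * σ := by linarith
  have hhi : Integrable h μ := integrable_of_abs_le hh.aestronglyMeasurable hhr
  obtain ⟨u, hus, hu, huc, hui⟩ := hhi.exists_hasCompactSupport_integral_sub_le (half_pos he)
  have hqs : HasCompactSupport (fun x => clamp (r - 2 * σ) (u x)) :=
    hus.comp_left (clamp_zero hρ)
  have hqc : Continuous (fun x => clamp (r - 2 * σ) (u x)) := (continuous_clamp _).comp huc
  obtain ⟨g, hg, hgd, hgs⟩ := hqc.exists_contDiff_approx 2 (ε := fun _ => σ) (by fun_prop)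
    (fun _ => hσ0)
  have hgd' : ∀ x, |g x - clamp (r - 2 * σ) (u x)| ≤ σ := fun x => by
    have := (hgd x).le
    rwa [Real.dist_eq] at this
  have hgb : ∀ x, |g x| ≤ r - σ := fun x => by
    have h1 := abs_clamp_le hρ (u x)
    have h2 := hgd' x
    have h3 := abs_sub_abs_le_abs_sub (g x) (clamp (r - 2 * σ) (u x))
    linarith
  refine ⟨g, hg, hqs.mono hgs, ⟨r - σ, by linarith, hgb⟩, ?_⟩
  have hbound : ∀ x, |h x - g x| ≤ ‖h x - u x‖ + 3 * σ := fun x => by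
    have h1 := abs_sub_clamp_le (ρ := r - 2 * σ) (σ := 2 * σ) (x := u x) (y := h x)
      (by linarith) hρ (by linarith [hhr x])
    have h2 := abs_sub_le (h x) (clamp (r - 2 * σ) (u x)) (g x)
    rw [abs_sub_comm (clamp _ _) (g x)] at h2
    rw [Real.norm_eq_abs]
    linarith [hgd' x]
  have hgi : Integrable g μ := integrable_of_abs_le hg.continuous.aestronglyMeasurable hgb
  have hle := integral_mono (hhi.sub hgi).abs
    ((hhi.sub hui).norm.add (integrable_const (3 * σ))) hbound
  rw [integral_add' (hhi.sub hui).norm (integrable_const _), integral_const] at hle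
  simp only [Pi.sub_apply, probReal_univ, one_smul] at hle
  linarith

/-- A measurable function with values in an open interval is an a.e. limit of smooth functions
with values in compact subintervals. -/
lemma exists_smooth_seq_tendsto_ae (μ : Measure ℝ) [IsProbabilityMeasure μ] {f : ℝ → ℝ}
    (hf : Measurable f) {a b : ℝ} (hfab : ∀ x, f x ∈ Ioo a b) :
    ∃ g g' : ℕ → ℝ → ℝ, (∀ n x, HasDerivAt (g n) (g' n x) x) ∧
      (∀ n, ∃ M, TaylorBound (g n) (g' n) M) ∧
      (∀ n, ∃ c d, a < c ∧ d < b ∧ ∀ x, g n x ∈ Icc c d) ∧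
      ∀ᵐ x ∂μ, Tendsto (fun n => g n x) atTop (𝓝 (f x)) := by
  have hab : a < b := (hfab 0).1.trans (hfab 0).2
  set m := (a + b) / 2 with hm
  set r := (b - a) / 2 with hr
  have hr0 : 0 < r := by rw [hr]; linarith
  have hhr : ∀ x, |f x - m| ≤ r := fun x =>
    abs_le.2 ⟨by linarith [(hfab x).1], by linarith [(hfab x).2]⟩
  have hhm : Measurable fun x => f x - m := hf.sub_const m
  choose h hc hs hρ hL using fun n : ℕ =>
    exists_smooth_approx (μ := μ) hhm hr0 hhr (Nat.one_div_pos_of_nat (α := ℝ) (n := n))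
  choose ρ hρr hρ using hρ
  have hhi : ∀ n, Integrable (fun x => f x - m - h n x) μ := fun n =>
    (integrable_of_abs_le hhm.aestronglyMeasurable hhr).sub
      (integrable_of_abs_le (hc n).continuous.aestronglyMeasurable (hρ n))
  -- Convergence in `L¹` gives convergence in measure, and hence almost everywhere along a
  -- subsequence.
  have htend : TendstoInMeasure μ h atTop (fun x => f x - m) := by
    refine tendstoInMeasure_of_tendsto_eLpNorm one_ne_zero
      (fun n => (hc n).continuous.aestronglyMeasurable) hhm.aestronglyMeasurable ?_
    have h1 : ∀ n, eLpNorm (h n - fun x => f x - m) 1 μ ≤ ENNReal.ofReal (1 / ((n : ℝ) + 1)) := by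
      intro n
      rw [eLpNorm_sub_comm, eLpNorm_one_eq_lintegral_enorm]
      refine le_trans (le_of_eq ?_) (ENNReal.ofReal_le_ofReal (hL n))
      rw [ofReal_integral_eq_lintegral_ofReal (hhi n).abs (ae_of_all _ fun x => abs_nonneg _)]
      refine lintegral_congr fun x => ?_
      rw [← ofReal_norm]; rfl
    have h2 : Tendsto (fun n : ℕ => ENNReal.ofReal (1 / ((n : ℝ) + 1))) atTop (𝓝 0) := by
      rw [← ENNReal.ofReal_zero]
      exact (ENNReal.continuous_ofReal.tendsto 0).comp tendsto_one_div_add_atTop_nhds_zero_nat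
    exact tendsto_of_tendsto_of_tendsto_of_le_of_le tendsto_const_nhds h2 (fun _ => zero_le) h1
  obtain ⟨ns, -, hns⟩ := htend.exists_seq_tendsto_ae
  refine ⟨fun n x => m + h (ns n) x, fun n => deriv (h (ns n)),
    fun n => (TaylorBound.exists_of_contDiff_hasCompactSupport (hc _) (hs _) m).1,
    fun n => (TaylorBound.exists_of_contDiff_hasCompactSupport (hc _) (hs _) m).2,
    fun n => ⟨m - ρ (ns n), m + ρ (ns n), by linarith [hρr (ns n)], by linarith [hρr (ns n)],
      fun x => ?_⟩, ?_⟩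
  · have := abs_le.1 (hρ (ns n) x)
    exact ⟨by linarith, by linarith⟩
  · filter_upwards [hns] with x hx
    simpa using hx.const_add m

/-! ### Limits of the interpolation and passage to measurable functions -/

section main

variable {k : ℕ} {A : Matrix (Fin k) (Fin k) ℝ} {J : (Fin k → ℝ) → ℝ≥0∞ → ℝ}
  {Ω : Set (Fin k → ℝ)} {ε : ℝ}

lemma tendsto_interpolant_nhdsGT {f f' : Fin k → ℝ → ℝ} {c d : Fin k → ℝ} {M : ℝ}
    (hJ_bdd : ∃ C : ℝ, ∀ x ∈ Ω, ∀ t : ℝ≥0∞, |J x t| ≤ C)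
    (hJc : ContinuousOn (fun p : (Fin k → ℝ) × ℝ≥0∞ => J p.1 p.2) (Ω ×ˢ univ)) (hε : 0 ≤ ε)
    (hf : ∀ i, TaylorBound (f i) (f' i) M) (hfcd : ∀ i z, f i z ∈ Icc (c i) (d i))
    (hcd : Icc c d ⊆ Ω) :
    Tendsto (interpolant A J f ε) (𝓝[>] 0)
      (𝓝 (∫ x, J (ouVector A f ε x) 0 ∂multivariateGaussian 0 A)) := by
  obtain ⟨B, hB⟩ := hJ_bdd
  refine tendsto_integral_filter_of_dominated_convergence (fun _ => B) ?_
    (Eventually.of_forall fun t => ae_of_all _ fun x => hB _ (hcd (ouVector_mem hf hfcd _ x)) _)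
    (integrable_const _) (ae_of_all _ fun x => ?_)
  · filter_upwards [self_mem_nhdsWithin] with t ht
    exact (continuous_comp_of_mem hJc (continuous_ouVector hf hfcd
      (add_nonneg (le_of_lt ht) hε)) (fun x => hcd (ouVector_mem hf hfcd _ x))
      _).aestronglyMeasurable
  · refine tendsto_comp_of_mem hJc (tendsto_pi_nhds.2 fun i => ?_) ?_
      (fun t => hcd (ouVector_mem hf hfcd _ x)) (hcd (ouVector_mem hf hfcd _ x))
    · have h1 := (continuous_ouSemigroup_time (hf i).continuous
        (abs_le_of_forall_mem_Icc (hfcd i)) (A i i).toNNReal (x i)).tendsto ε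
      have h2 : Tendsto (fun t : ℝ => t + ε) (𝓝[>] 0) (𝓝 ε) := by
        have : Tendsto (fun t : ℝ => t + ε) (𝓝 0) (𝓝 (0 + ε)) := tendsto_id.add_const ε
        rw [zero_add] at this
        exact this.mono_left nhdsWithin_le_nhds
      exact h1.comp h2
    · have := ENNReal.continuous_ofReal.tendsto 0
      rw [ENNReal.ofReal_zero] at this
      exact this.mono_left nhdsWithin_le_nhds

lemma tendsto_interpolant_atTop {f f' : Fin k → ℝ → ℝ} {c d : Fin k → ℝ} {M : ℝ}
    (hJ_bdd : ∃ C : ℝ, ∀ x ∈ Ω, ∀ t : ℝ≥0∞, |J x t| ≤ C)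
    (hJc : ContinuousOn (fun p : (Fin k → ℝ) × ℝ≥0∞ => J p.1 p.2) (Ω ×ˢ univ)) (hε : 0 ≤ ε)
    (hf : ∀ i, TaylorBound (f i) (f' i) M) (hfcd : ∀ i z, f i z ∈ Icc (c i) (d i))
    (hcd : Icc c d ⊆ Ω) :
    Tendsto (interpolant A J f ε) atTop
      (𝓝 (J (fun i => ∫ z, f i z ∂gaussianReal 0 (A i i).toNNReal) ⊤)) := by
  obtain ⟨B, hB⟩ := hJ_bdd
  have hpt : ∀ (i : Fin k) (x : ℝ), Tendsto
      (fun t : ℝ => ouSemigroup (A i i).toNNReal (t + ε) (f i) x)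
      atTop (𝓝 (∫ z, f i z ∂gaussianReal 0 (A i i).toNNReal)) := fun i x =>
    (tendsto_ouSemigroup_atTop (hf i).continuous (abs_le_of_forall_mem_Icc (hfcd i)) _ x).comp
      (tendsto_atTop_add_const_right _ ε tendsto_id)
  have hm0 : (fun i => ∫ z, f i z ∂gaussianReal 0 (A i i).toNNReal) ∈ Icc c d :=
    ⟨fun i => ge_of_tendsto (hpt i 0) (Eventually.of_forall fun t =>
        (ouSemigroup_mem_Icc (hf i).continuous.measurable (hfcd i) _ _).1),
      fun i => le_of_tendsto (hpt i 0) (Eventually.of_forall fun t =>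
        (ouSemigroup_mem_Icc (hf i).continuous.measurable (hfcd i) _ _).2)⟩
  have key : Tendsto (interpolant A J f ε) atTop
      (𝓝 (∫ _, J (fun i => ∫ z, f i z ∂gaussianReal 0 (A i i).toNNReal) ⊤
        ∂multivariateGaussian 0 A)) := by
    refine tendsto_integral_filter_of_dominated_convergence (fun _ => B) ?_
      (Eventually.of_forall fun t => ae_of_all _ fun x => hB _ (hcd (ouVector_mem hf hfcd _ x)) _)
      (integrable_const _) (ae_of_all _ fun x => ?_)
    · filter_upwards [eventually_ge_atTop 0] with t ht
      exact (continuous_comp_of_mem hJc (continuous_ouVector hf hfcd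
        (add_nonneg ht hε)) (fun x => hcd (ouVector_mem hf hfcd _ x)) _).aestronglyMeasurable
    · exact tendsto_comp_of_mem hJc (tendsto_pi_nhds.2 fun i => hpt i (x i))
        ENNReal.tendsto_ofReal_atTop (fun t => hcd (ouVector_mem hf hfcd _ x)) (hcd hm0)
  simpa using key

/-- The inequality for smooth functions with values in a compact box. -/
lemma noise_inequality_of_smooth (hA : A.PosSemidef) (hΩ : IsOpen Ω)
    (hJ_bdd : ∃ C : ℝ, ∀ x ∈ Ω, ∀ t : ℝ≥0∞, |J x t| ≤ C)
    (hJc : ContinuousOn (fun p : (Fin k → ℝ) × ℝ≥0∞ => J p.1 p.2) (Ω ×ˢ univ))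
    (hJ2 : ContDiffOn ℝ 2 (realTime J) (Ω ×ˢ Ioi (0 : ℝ)))
    {lam : Fin k → ℝ} (hlam : ∀ i, 0 ≤ lam i) (hsum : ∑ i, lam i = 1) (hε : 0 ≤ ε)
    (hJ_time : ∀ x ∈ Ω, ∀ t : ℝ, 0 < t → timeDeriv J x t ≤ 0)
    (hJ_hess : ∀ x ∈ Ω, ∀ t : ℝ, 0 < t →
      (A ⊙ hessianMatrix (fun y => J y (ENNReal.ofReal t)) x
        - ((Real.exp (2 * (t + ε)) - 1) * timeDeriv J x t) • weightMatrix A lam x).PosSemidef)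
    {f f' : Fin k → ℝ → ℝ} {c d : Fin k → ℝ} {M : ℝ}
    (hf : ∀ i, TaylorBound (f i) (f' i) M) (hder : ∀ i x, HasDerivAt (f i) (f' i x) x)
    (hfcd : ∀ i z, f i z ∈ Icc (c i) (d i)) (hcd : Icc c d ⊆ Ω)
    (hc0 : ∀ i, 0 < c i) (hd1 : ∀ i, d i < 1) :
    J (fun i => ∫ z, f i z ∂gaussianReal 0 (A i i).toNNReal) ⊤
      ≤ ∫ x, J (ouVector A f ε x) 0 ∂multivariateGaussian 0 A := by
  have hanti : ∀ t₀ t₁ : ℝ, 0 < t₀ → t₀ < t₁ →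
      interpolant A J f ε t₁ ≤ interpolant A J f ε t₀ := fun t₀ t₁ h0 h01 =>
    le_of_eventually_step h01 fun ω hω => eventually_interpolant_step hA hΩ hJ_bdd hJc hJ2 hlam
      hsum hε hJ_time hJ_hess hf hder hfcd hcd hc0 hd1 h0 hω
  -- Monotonicity is known only between positive finite times, where `J` is `C²`. Continuity of `J`
  -- up to times `0` and `∞` supplies the endpoints.
  refine ge_of_tendsto (tendsto_interpolant_nhdsGT hJ_bdd hJc hε hf hfcd hcd) ?_
  filter_upwards [self_mem_nhdsWithin] with t₀ ht₀
  refine le_of_tendsto (tendsto_interpolant_atTop hJ_bdd hJc hε hf hfcd hcd) ?_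
  filter_upwards [eventually_gt_atTop t₀] with t₁ ht₁
  exact hanti t₀ t₁ ht₀ ht₁

/-- Almost everywhere convergence under `N(0, v)` is preserved by the Ornstein-Uhlenbeck
semigroup. -/
lemma ae_tendsto_ouSemigroup {v : ℝ≥0} {g : ℕ → ℝ → ℝ} {f : ℝ → ℝ} {B : ℝ} (hε : 0 ≤ ε)
    (hg : ∀ n, Measurable (g n)) (hB : ∀ n x, |g n x| ≤ B)
    (h : ∀ᵐ x ∂gaussianReal 0 v, Tendsto (fun n => g n x) atTop (𝓝 (f x))) :
    ∀ᵐ x ∂gaussianReal 0 v,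
      Tendsto (fun n => ouSemigroup v ε (g n) x) atTop (𝓝 (ouSemigroup v ε f x)) := by
  have hmap := integral_ou_prod (gaussianReal 0 v) (by simp [integral_id_gaussianReal]) hε
  -- By invariance, a null set of `N(0, v)` pulls back to a null set of pairs `(x, z)`, so for
  -- almost every `x` convergence holds for almost every `z`. This also covers `ε = 0`.
  rw [← hmap] at h
  have h2 := Measure.ae_ae_of_ae_prod (ae_of_ae_map (by fun_prop) h)
  filter_upwards [h2] with x hx
  refine tendsto_integral_of_dominated_convergence (fun _ => B)
    (fun n => ((hg n).comp (by fun_prop)).aestronglyMeasurable) (integrable_const _)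
    (fun n => ae_of_all _ fun z => hB n _) ?_
  exact hx

end main

theorem mainTheorem4 {k : ℕ} (A : Matrix (Fin k) (Fin k) ℝ) (hA : A.PosSemidef)
    -- `Ω = ∏ (a i, b i)`, a product of open subintervals of `[0, 1]`
    (a b : Fin k → ℝ) (ha : ∀ i, 0 ≤ a i) (hb : ∀ i, b i ≤ 1)
    (Ω : Set (Fin k → ℝ)) (hΩ : Ω = Set.univ.pi fun i => Set.Ioo (a i) (b i))
    (J : (Fin k → ℝ) → ℝ≥0∞ → ℝ)
    (hJ_bdd : ∃ C : ℝ, ∀ x ∈ Ω, ∀ t : ℝ≥0∞, |J x t| ≤ C)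
    (hJ_cont : ContinuousOn (fun p : (Fin k → ℝ) × ℝ≥0∞ => J p.1 p.2) (Ω ×ˢ Set.univ))
    (hJ_C2 : ContDiffOn ℝ 2
      (fun p : (Fin k → ℝ) × ℝ => J p.1 (ENNReal.ofReal p.2)) (Ω ×ˢ Set.Ioi (0 : ℝ)))
    (lam : Fin k → ℝ) (hlam_nonneg : ∀ i, 0 ≤ lam i) (hlam_sum : ∑ i, lam i = 1)
    (ε : ℝ) (hε : 0 ≤ ε)
    (hJ_time : ∀ x ∈ Ω, ∀ t : ℝ, 0 < t → timeDeriv J x t ≤ 0)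
    (hJ_hess : ∀ x ∈ Ω, ∀ t : ℝ, 0 < t →
      (A ⊙ hessianMatrix (fun y => J y (ENNReal.ofReal t)) x
        - ((Real.exp (2 * (t + ε)) - 1) * timeDeriv J x t) • weightMatrix A lam x).PosSemidef)
    {Ω' : Type*} [MeasurableSpace Ω'] (P : Measure Ω') [IsProbabilityMeasure P]
    (X : Ω' → EuclideanSpace ℝ (Fin k)) (hX : HasLaw X (multivariateGaussian 0 A) P)
    (f : Fin k → ℝ → ℝ) (hf_meas : ∀ i, Measurable (f i))
    (hf_mem : ∀ i z, f i z ∈ Set.Ioo (a i) (b i)) :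
    J (fun i => ∫ ω, f i (X ω i) ∂P) ⊤
      ≤ ∫ ω, J (fun i => ouSemigroup (A i i).toNNReal ε (f i) (X ω i)) 0 ∂P := by
  have hΩo : IsOpen Ω := by
    rw [hΩ]; exact isOpen_set_pi finite_univ fun i _ => isOpen_Ioo
  choose g g' hder hM hcd hlim using fun i =>
    exists_smooth_seq_tendsto_ae (gaussianReal 0 (A i i).toNNReal) (hf_meas i) (hf_mem i)
  choose M hM using hM
  choose c d hac hdb hgcd using hcd
  -- The smooth case asks for one constant common to all coordinates; it may depend on `n`.
  have hMn : ∀ n i, TaylorBound (g i n) (g' i n) (∑ j, M j n) := fun n i =>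
    (hM i n).mono (Finset.single_le_sum (f := fun j => M j n)
      (fun j _ => (hM j n).nonneg) (Finset.mem_univ i))
  have hbox : ∀ n, Icc (fun i => c i n) (fun i => d i n) ⊆ Ω := fun n x hx => by
    rw [hΩ]
    exact fun i _ => ⟨(hac i n).trans_le (hx.1 i), (hx.2 i).trans_lt (hdb i n)⟩
  have hsmooth := fun n => noise_inequality_of_smooth hA hΩo hJ_bdd hJ_cont hJ_C2 hlam_nonneg
    hlam_sum hε hJ_time hJ_hess (hMn n) (fun i => hder i n) (fun i => hgcd i n) (hbox n)
    (fun i => (ha i).trans_lt (hac i n)) (fun i => (hdb i n).trans_le (hb i))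
  have hgB : ∀ i n x, |g i n x| ≤ 1 := fun i n x => abs_le_one_of_mem_Icc
    ⟨(ha i).trans ((hac i n).le.trans (hgcd i n x).1),
      (hgcd i n x).2.trans ((hdb i n).le.trans (hb i))⟩
  -- Averages stay strictly inside the open interval, since a strictly positive function has a
  -- strictly positive integral. Strictness matters because `J` is controlled only on the open box.
  have hmean : ∀ (v : ℝ≥0) i {h : ℝ → ℝ}, Measurable h → (∀ z, h z ∈ Ioo (a i) (b i)) →
      ∫ z, h z ∂gaussianReal 0 v ∈ Ioo (a i) (b i) := fun v i h hh hmem => by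
    have hi : Integrable h (gaussianReal 0 v) := integrable_of_abs_le hh.aestronglyMeasurable
      fun z => abs_le_max_abs_abs (hmem z).1.le (hmem z).2.le
    have hpos : ∀ {q : ℝ → ℝ}, Integrable q (gaussianReal 0 v) → (∀ z, 0 < q z) →
        0 < ∫ z, q z ∂gaussianReal 0 v := fun {q} hq hq0 => by
      rw [integral_pos_iff_support_of_nonneg (fun z => (hq0 z).le) hq,
        show Function.support q = univ from eq_univ_of_forall fun z => (hq0 z).ne']
      simp
    have h1 := hpos (hi.sub (integrable_const (a i))) fun z => sub_pos.2 (hmem z).1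
    have h2 := hpos ((integrable_const (b i)).sub hi) fun z => sub_pos.2 (hmem z).2
    simp only [Pi.sub_apply] at h1 h2
    rw [integral_sub hi (integrable_const _)] at h1
    rw [integral_sub (integrable_const _) hi] at h2
    simp only [integral_const, probReal_univ, one_smul, sub_pos] at h1 h2
    exact ⟨h1, h2⟩
  have hou : ∀ i x, ouSemigroup (A i i).toNNReal ε (f i) x ∈ Ioo (a i) (b i) := fun i x =>
    hmean _ i ((hf_meas i).comp (by fun_prop)) fun z => hf_mem i _
  have hgΩ : ∀ n i z, g i n z ∈ Ioo (a i) (b i) := fun n i z =>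
    ⟨(hac i n).trans_le (hgcd i n z).1, (hgcd i n z).2.trans_lt (hdb i n)⟩
  have hleft : Tendsto
      (fun n => J (fun i => ∫ z, g i n z ∂gaussianReal 0 (A i i).toNNReal) ⊤) atTop
      (𝓝 (J (fun i => ∫ z, f i z ∂gaussianReal 0 (A i i).toNNReal) ⊤)) := by
    refine tendsto_comp_of_mem hJ_cont (tendsto_pi_nhds.2 fun i => ?_) tendsto_const_nhds
      (fun n => ?_) ?_
    · exact tendsto_integral_of_dominated_convergence (fun _ => 1)
        (fun n => (hM i n).continuous.aestronglyMeasurable) (integrable_const _)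
        (fun n => ae_of_all _ (hgB i n)) (hlim i)
    · rw [hΩ]
      exact fun i _ => hmean _ i (hM i n).continuous.measurable (hgΩ n i)
    · rw [hΩ]
      exact fun i _ => hmean _ i (hf_meas i) (hf_mem i)
  have hae : ∀ᵐ x ∂multivariateGaussian 0 A, Tendsto
      (fun n => J (ouVector A (fun i => g i n) ε x) 0) atTop (𝓝 (J (ouVector A f ε x) 0)) := by
    have h1 : ∀ i, ∀ᵐ x ∂multivariateGaussian 0 A, Tendsto
        (fun n => ouSemigroup (A i i).toNNReal ε (g i n) (x i)) atTop
        (𝓝 (ouSemigroup (A i i).toNNReal ε (f i) (x i))) := fun i => by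
      have hev := measurePreserving_eval_multivariateGaussian (μ := 0) hA (i := i)
      have hlim' := ae_tendsto_ouSemigroup hε (fun n => (hM i n).continuous.measurable) (hgB i)
        (hlim i)
      refine hev.quasiMeasurePreserving.ae (p := fun u => Tendsto
        (fun n => ouSemigroup (A i i).toNNReal ε (g i n) u) atTop
        (𝓝 (ouSemigroup (A i i).toNNReal ε (f i) u))) ?_
      simpa using hlim'
    filter_upwards [ae_all_iff.2 h1] with x hx
    refine tendsto_comp_of_mem hJ_cont (tendsto_pi_nhds.2 hx) tendsto_const_nhds
      (fun n => hbox n (ouVector_mem (hMn n) (fun i => hgcd i n) _ _)) ?_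
    rw [hΩ]
    exact fun i _ => hou i (x i)
  have hmeas : ∀ n, AEStronglyMeasurable (fun x => J (ouVector A (fun i => g i n) ε x) 0)
      (multivariateGaussian 0 A) := fun n =>
    (continuous_comp_of_mem hJ_cont (continuous_ouVector (hMn n) (fun i => hgcd i n) hε)
      (fun x => hbox n (ouVector_mem (hMn n) (fun i => hgcd i n) _ _)) _).aestronglyMeasurable
  have hright : Tendsto
      (fun n => ∫ x, J (ouVector A (fun i => g i n) ε x) 0 ∂multivariateGaussian 0 A) atTop
      (𝓝 (∫ x, J (ouVector A f ε x) 0 ∂multivariateGaussian 0 A)) := by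
    obtain ⟨B, hB⟩ := hJ_bdd
    exact tendsto_integral_of_dominated_convergence (fun _ => B) hmeas (integrable_const _)
      (fun n => ae_of_all _ fun x =>
        hB _ (hbox n (ouVector_mem (hMn n) (fun i => hgcd i n) _ _)) _) hae
  have hfinal := le_of_tendsto_of_tendsto' hleft hright hsmooth
  have eL : (fun i => ∫ ω, f i (X ω i) ∂P)
      = fun i => ∫ z, f i z ∂gaussianReal 0 (A i i).toNNReal := by
    ext i
    rw [← integral_eval_comp_multivariateGaussian hA i (hf_meas i)]
    exact hX.integral_comp (f := fun y : EuclideanSpace ℝ (Fin k) => f i (y i))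
      ((hf_meas i).comp (by fun_prop)).aestronglyMeasurable
  -- The integrand is measurable up to null sets as an almost everywhere limit of the continuous
  -- approximants.
  have eR : ∫ ω, J (fun i => ouSemigroup (A i i).toNNReal ε (f i) (X ω i)) 0 ∂P
      = ∫ x, J (ouVector A f ε x) 0 ∂multivariateGaussian 0 A :=
    hX.integral_comp (f := fun y => J (ouVector A f ε y) 0)
      (aestronglyMeasurable_of_tendsto_ae _ hmeas hae)
  rw [eL, eR]
  exact hfinal
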